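/- Let $\mathbb D$ be the open unit disc in $\mathbb C$, $H(\mathbb D)$ the space of analytic functions on $\mathbb D$, and $dA$ the area measure normalized so that $A(\mathbb D)=1$. For $1<p<\infty$ let $B_p$ be the Besov space of all $f\in H(\mathbb D)$ with $$\|f\|_{B_p}=|f(0)|+\Big(\int_{\mathbb D}|f'(z)|^p(1-|z|^2)^{p-2}\,dA(z)\Big)^{1/p}<\infty .$$ Let $\mathcal B$ be the Bloch space of all $f\in H(\mathbb D)$ with $\sup_{z\in\mathbb D}(1-|z|^2)|f'(z)|<\infty$. For $1<s<\infty$ let $\Lambda^s_{1/s}$ be the mean Lipschitz space of all $f\in H(\mathbb D)$ with $$\sup_{0<r<1}(1-r)^{1-1/s}\Big(\frac1{2\pi}\int_0^{2\pi}|f'(re^{i\theta})|^s\,d\theta\Big)^{1/s}<\infty .$$ For a finite positive Borel measure $\mu$ on $[0,1)$ put $\mu_n=\int_{[0,1)}t^n\,d\mu(t)$ and, for $f(z)=\sum_{n\ge0}a_nz^n$ in $H(\mathbb D)$, $$\mathcal C_\mu(f)(z)=\sum_{n=0}^\infty\Big(\mu_n\sum_{k=0}^n a_k\Big)z^n,\qquad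 z\in\mathbb D .$$ **Theorem.** Suppose $1<p<\infty$, $1<s<\infty$, $\frac1p+\frac1q=1$, $X$ is a Banach space of analytic functions in $\mathbb D$ (a complex Banach space whose elements are functions in $H(\mathbb D)$, with pointwise linear operations, and on which every point evaluation $f\mapsto f(z)$, $z\in\mathbb D$, is continuous) with $\Lambda^s_{1/s}\subseteq X\subseteq\mathcal B$, and $\mu$ is a finite positive Borel measure on $[0,1)$. Then the following conditions are equivalent: (i) $\mathcal C_\mu$ is a compact operator from $B_p$ into $X$; (ii) $\mu$ is a vanishing $\frac1q$-logarithmic $1$-Carleson measure, that is, $$\lim_{t\to1^-}\frac{\mu([t,1))\big(\log\frac{e}{1-t}\big)^{1/q}}{1-t}=0 .$$ -/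

import Mathlib

open MeasureTheory Filter Topology
open scoped ENNReal

/-- `H(𝔻)`: the complex vector space of analytic functions on the open unit disc. A function on
the disc is represented by its extension by zero to `ℂ`, so that two elements are equal if and only
if they agree on the disc. -/
def HolDisc : Submodule ℂ (ℂ → ℂ) where
  carrier := {f | DifferentiableOn ℂ f (Metric.ball 0 1) ∧ ∀ z ∉ Metric.ball (0 : ℂ) 1, f z = 0}
  add_mem' := by
    rintro f g ⟨hf, hf0⟩ ⟨hg, hg0⟩
    exact ⟨hf.add hg, fun z hz => by simp [hf0 z hz, hg0 z hz]⟩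
  zero_mem' := ⟨differentiableOn_const 0, fun _ _ => rfl⟩
  smul_mem' := by
    rintro c f ⟨hf, hf0⟩
    exact ⟨hf.const_smul c, fun z hz => by simp [hf0 z hz]⟩

/-- Area measure `dA` on `ℂ`, normalized so that the unit disc has measure `1`. -/
noncomputable def areaMeasure : Measure ℂ := ENNReal.ofReal (Real.pi⁻¹) • volume

/-- `(∫_𝔻 |f'(z)|^p (1 - |z|²)^(p-2) dA(z))^(1/p)`, with value in `[0, ∞]`. -/
noncomputable def besovSeminorm (p : ℝ) (f : ℂ → ℂ) : ℝ≥0∞ :=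
  (∫⁻ z in Metric.ball (0 : ℂ) 1,
    ‖deriv f z‖ₑ ^ p * ENNReal.ofReal ((1 - ‖z‖ ^ 2) ^ (p - 2)) ∂areaMeasure) ^ (1 / p)

/-- Auxiliary: the weighted measure `(1 - |z|²)^(p-2) dA(z)` on the disc. -/
noncomputable def besovMeasure (p : ℝ) : Measure ℂ :=
  (areaMeasure.restrict (Metric.ball 0 1)).withDensity
    fun z => ENNReal.ofReal ((1 - ‖z‖ ^ 2) ^ (p - 2))

theorem measurable_besovWeight (p : ℝ) :
    Measurable fun z : ℂ => ENNReal.ofReal ((1 - ‖z‖ ^ 2) ^ (p - 2)) := by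
  fun_prop

theorem besovSeminorm_eq (p : ℝ) (f : ℂ → ℂ) :
    besovSeminorm p f = eLpNorm' (deriv f) p (besovMeasure p) := by
  have hd : Measurable (deriv f) := measurable_deriv f
  unfold besovSeminorm eLpNorm' besovMeasure
  rw [lintegral_withDensity_eq_lintegral_mul _ (measurable_besovWeight p)
    (hd.enorm.pow_const p)]
  congr 1
  refine lintegral_congr fun z => ?_
  simp [mul_comm]

theorem ae_mem_ball_besovMeasure (p : ℝ) : ∀ᵐ z ∂besovMeasure p, z ∈ Metric.ball (0 : ℂ) 1 :=
  (withDensity_absolutelyContinuous _ _).ae_le (ae_restrict_mem Metric.isOpen_ball.measurableSet)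

theorem HolDisc_differentiableAt (f : HolDisc) {z : ℂ} (hz : z ∈ Metric.ball (0 : ℂ) 1) :
    DifferentiableAt ℂ (f : ℂ → ℂ) z :=
  f.2.1.differentiableAt (Metric.isOpen_ball.mem_nhds hz)

theorem besovSeminorm_add_le {p : ℝ} (hp : 1 < p) (f g : HolDisc) :
    besovSeminorm p (f + g : HolDisc) ≤ besovSeminorm p f + besovSeminorm p g := by
  simp only [besovSeminorm_eq]
  have h : deriv ((f + g : HolDisc) : ℂ → ℂ) =ᵐ[besovMeasure p]
      deriv (f : ℂ → ℂ) + deriv (g : ℂ → ℂ) := by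
    filter_upwards [ae_mem_ball_besovMeasure p] with z hz
    exact deriv_add (HolDisc_differentiableAt f hz) (HolDisc_differentiableAt g hz)
  rw [eLpNorm'_congr_ae h]
  exact eLpNorm'_add_le (measurable_deriv _).aestronglyMeasurable
    (measurable_deriv _).aestronglyMeasurable hp.le

theorem besovSeminorm_smul {p : ℝ} (hp : 1 < p) (c : ℂ) (f : HolDisc) :
    besovSeminorm p (c • f : HolDisc) = ‖c‖ₑ * besovSeminorm p f := by
  simp only [besovSeminorm_eq]
  have h : deriv ((c • f : HolDisc) : ℂ → ℂ) =ᵐ[besovMeasure p] c • deriv (f : ℂ → ℂ) := by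
    filter_upwards [ae_mem_ball_besovMeasure p] with z hz
    exact deriv_const_smul c (HolDisc_differentiableAt f hz)
  rw [eLpNorm'_congr_ae h]
  exact eLpNorm'_const_smul c (by linarith)

theorem HolDisc.eq_zero_of_besovSeminorm {p : ℝ} (hp : 1 < p) (f : HolDisc)
    (h : besovSeminorm p f = 0) (h0 : (f : ℂ → ℂ) 0 = 0) : f = 0 := by
  rw [besovSeminorm_eq, eLpNorm'_eq_zero_iff (by linarith)
    (measurable_deriv _).aestronglyMeasurable] at h
  have h1 : ∀ᵐ z ∂((volume : Measure ℂ).restrict (Metric.ball 0 1)),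
      deriv (f : ℂ → ℂ) z = 0 := by
    have h2 := (ae_withDensity_iff (measurable_besovWeight p)).1 h
    have h3 : (volume : Measure ℂ).restrict (Metric.ball 0 1) ≪
        areaMeasure.restrict (Metric.ball 0 1) := by
      unfold areaMeasure
      rw [Measure.restrict_smul]
      exact Measure.absolutelyContinuous_smul (by simp [Real.pi_pos])
    filter_upwards [h3.ae_le h2, ae_restrict_mem Metric.isOpen_ball.measurableSet] with z hz hb
    apply hz
    have hz1 : ‖z‖ < 1 := by simpa using hb
    have : 0 < 1 - ‖z‖ ^ 2 := by nlinarith [norm_nonneg z]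
    simpa using Real.rpow_pos_of_pos this _
  have h4 : Set.EqOn (deriv (f : ℂ → ℂ)) 0 (Metric.ball 0 1) :=
    Measure.eqOn_open_of_ae_eq h1 Metric.isOpen_ball
      (f.2.1.deriv Metric.isOpen_ball).continuousOn continuousOn_const
  ext z
  by_cases hz : z ∈ Metric.ball (0 : ℂ) 1
  · have := Metric.isOpen_ball.is_const_of_deriv_eq_zero
      (convex_ball (0 : ℂ) 1).isPreconnected f.2.1 h4 hz (Metric.mem_ball_self one_pos)
    rw [this, h0]; rfl
  · exact f.2.2 z hz

/-- The functions `f ∈ H(𝔻)` with `∫_𝔻 |f'(z)|^p (1 - |z|²)^(p-2) dA(z) < ∞`. -/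
noncomputable def besovSubmodule (p : ℝ) [hp : Fact (1 < p)] : Submodule ℂ HolDisc where
  carrier := {f | besovSeminorm p f < ∞}
  add_mem' := fun {f g} hf hg =>
    (besovSeminorm_add_le hp.out f g).trans_lt (ENNReal.add_lt_top.2 ⟨hf, hg⟩)
  zero_mem' := by
    have := besovSeminorm_smul hp.out 0 0
    simp only [zero_smul, enorm_zero, zero_mul] at this
    simp only [Set.mem_ofPred_eq, this, ENNReal.zero_lt_top]
  smul_mem' := fun c f hf => by
    simp only [Set.mem_ofPred_eq, besovSeminorm_smul hp.out]
    exact ENNReal.mul_lt_top (by simp) hf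

/-- The Besov space `B_p`, `1 < p < ∞`; it carries the topology of its norm below. -/
def Besov (p : ℝ) [Fact (1 < p)] : Type := besovSubmodule p

namespace Besov

variable {p : ℝ} [hp : Fact (1 < p)]

noncomputable instance : AddCommGroup (Besov p) := inferInstanceAs (AddCommGroup (besovSubmodule p))

noncomputable instance : Module ℂ (Besov p) := inferInstanceAs (Module ℂ (besovSubmodule p))

/-- The inclusion of `B_p` into `H(𝔻)`. -/
noncomputable def toHol : Besov p →ₗ[ℂ] HolDisc := (besovSubmodule p).subtype

/-- `‖f‖_{B_p} = |f(0)| + (∫_𝔻 |f'(z)|^p (1 - |z|²)^(p-2) dA(z))^(1/p)`. -/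
noncomputable instance : Norm (Besov p) :=
  ⟨fun f => ‖(toHol f : ℂ → ℂ) 0‖ + (besovSeminorm p (toHol f)).toReal⟩

theorem norm_def (f : Besov p) :
    ‖f‖ = ‖(toHol f : ℂ → ℂ) 0‖ + (besovSeminorm p (toHol f)).toReal := rfl

theorem besovSeminorm_ne_top (f : Besov p) : besovSeminorm p (toHol f) ≠ ∞ :=
  (Subtype.property (p := fun f => f ∈ besovSubmodule p) f).ne

theorem toHol_injective : Function.Injective (toHol : Besov p → HolDisc) :=
  Subtype.val_injective

theorem core : NormedSpace.Core ℂ (Besov p) where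
  norm_nonneg f := by rw [norm_def]; positivity
  norm_smul c f := by
    rw [norm_def, norm_def, map_smul, besovSeminorm_smul hp.out, ENNReal.toReal_mul]
    simp [mul_add]
  norm_triangle f g := by
    have h := ENNReal.toReal_mono
      (ENNReal.add_ne_top.2 ⟨besovSeminorm_ne_top f, besovSeminorm_ne_top g⟩)
      (besovSeminorm_add_le hp.out (toHol f) (toHol g))
    rw [ENNReal.toReal_add (besovSeminorm_ne_top f) (besovSeminorm_ne_top g)] at h
    have h' := norm_add_le ((toHol f : ℂ → ℂ) 0) ((toHol g : ℂ → ℂ) 0)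
    simp only [norm_def, map_add]
    simp only [Submodule.coe_add, Pi.add_apply] at h h' ⊢
    linarith
  norm_eq_zero_iff f := by
    constructor
    · intro h
      rw [norm_def, add_eq_zero_iff_of_nonneg (norm_nonneg _) ENNReal.toReal_nonneg] at h
      apply toHol_injective
      rw [map_zero]
      exact HolDisc.eq_zero_of_besovSeminorm hp.out _
        (((ENNReal.toReal_eq_zero_iff _).1 h.2).resolve_right (besovSeminorm_ne_top f))
        (norm_eq_zero.1 h.1)
    · rintro rfl
      have := besovSeminorm_smul hp.out 0 0
      simp only [zero_smul, enorm_zero, zero_mul] at this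
      rw [norm_def, map_zero, this]
      simp

noncomputable instance : NormedAddCommGroup (Besov p) := NormedAddCommGroup.ofCore core

noncomputable instance : NormedSpace ℂ (Besov p) := NormedSpace.ofCore core

end Besov

/-- The Bloch space: `f ∈ H(𝔻)` with `sup_{z ∈ 𝔻} (1 - |z|²) |f'(z)| < ∞`. -/
def blochSpace : Set HolDisc :=
  {f | ∃ C : ℝ, ∀ z ∈ Metric.ball (0 : ℂ) 1, (1 - ‖z‖ ^ 2) * ‖deriv (f : ℂ → ℂ) z‖ ≤ C}

/-- The integral mean `M_s(r, g) = ((1/2π) ∫₀^{2π} |g(r e^{iθ})|^s dθ)^{1/s}`. -/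
noncomputable def integralMean (s r : ℝ) (g : ℂ → ℂ) : ℝ :=
  (1 / (2 * Real.pi) *
    ∫ θ in (0 : ℝ)..(2 * Real.pi), ‖g (r * Complex.exp (θ * Complex.I))‖ ^ s) ^ (1 / s)

/-- The mean Lipschitz space `Λ^s_α`: `f ∈ H(𝔻)` with
`sup_{0 < r < 1} (1 - r)^{1 - α} M_s(r, f') < ∞`. -/
def meanLipschitz (s α : ℝ) : Set HolDisc :=
  {f | ∃ C : ℝ, ∀ r : ℝ, 0 < r → r < 1 →
    (1 - r) ^ (1 - α) * integralMean s r (deriv (f : ℂ → ℂ)) ≤ C}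

/-- A complex normed space `X`, with a linear map `ι` into `H(𝔻)`, is a normed space of analytic
functions on the disc: its elements are (via `ι`) analytic functions, and the point evaluations
`x ↦ x(z)`, `z ∈ 𝔻`, are continuous on `X`. -/
structure IsSpaceOfAnalyticFunctions {X : Type*} [NormedAddCommGroup X] [NormedSpace ℂ X]
    (ι : X →ₗ[ℂ] HolDisc) : Prop where
  injective : Function.Injective ι
  continuous_eval : ∀ z ∈ Metric.ball (0 : ℂ) 1, Continuous fun x => (ι x : ℂ → ℂ) z

/-- The moment `μ_n = ∫_{[0,1)} t^n dμ(t)`. -/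
noncomputable def moment01 (μ : Measure (Set.Ico (0 : ℝ) 1)) (n : ℕ) : ℝ :=
  ∫ t, (t : ℝ) ^ n ∂μ

/-- The `n`-th Taylor coefficient of `f` at the origin. -/
noncomputable def taylorCoeff0 (f : ℂ → ℂ) (n : ℕ) : ℂ :=
  iteratedDeriv n f 0 / (n.factorial : ℂ)

/-- The Cesàro-like operator: `C_μ(f)(z) = ∑ₙ μ_n (∑_{k ≤ n} a_k) zⁿ` for `z ∈ 𝔻`, where
`f(z) = ∑ₙ a_n zⁿ`; extended by zero outside the disc. -/
noncomputable def cesaroLike (μ : Measure (Set.Ico (0 : ℝ) 1)) (f : HolDisc) : ℂ → ℂ :=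
  (Metric.ball (0 : ℂ) 1).indicator fun z =>
    ∑' n : ℕ, (moment01 μ n : ℂ) * (∑ k ∈ Finset.range (n + 1), taylorCoeff0 f k) * z ^ n

/-- `ν` is a vanishing `α`-logarithmic `s`-Carleson measure on `[0,1)`:
`ν([t,1)) (log (e/(1-t)))^α / (1-t)^s → 0` as `t → 1⁻`. -/
def IsVanishingLogCarleson (α s : ℝ) (ν : Measure (Set.Ico (0 : ℝ) 1)) : Prop :=
  Tendsto (fun t : ℝ => (ν {x | t ≤ (x : ℝ)}).toReal *
    Real.log (Real.exp 1 / (1 - t)) ^ α / (1 - t) ^ s) (𝓝[<] 1) (𝓝 0)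

/-! Everything rests on the formula `C_μ(f)(z) = ∫ f(tz)/(1 - tz) dμ(t)` (`cesaroLike_eq_integral`),
which comes from multiplying the Taylor series of `f` by the geometric series.

Sufficiency. A Besov function grows at most like `log(e/(1-|z|))^(1/q)`
(`Besov.exists_norm_apply_le`). Differentiating under the integral, using Cauchy's estimate for
`f(w)/(1-w)`, and summing the Carleson condition over dyadic tails gives `|C_μ(f)'(z)| ≤ C M ‖f‖
|1-z|^(ε-1) (1-|z|)^(-ε)`, where `M` is the Carleson constant (`exists_norm_deriv_cesaroLike_le`).
If `s(1-ε) > 1`, such a bound forces membership in `Λ^s_{1/s}`, hence in `X`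
(`SingularBound.mem_meanLipschitz`). The norm of `X` is unknown, so a closed graph argument turns
this membership into a norm inequality (`IsSpaceOfAnalyticFunctions.exists_norm_le`), and the
operator norm of `C_μ` is at most a constant times `M` (`exists_bounded_cesaro`). For a vanishing
measure the tail on `[ρ,1)` has arbitrarily small `M`, while the part on `[0,ρ)` gives a
norm-convergent series of rank-one operators (`exists_compact_cesaro_of_lt_one`). So `C_μ` is a norm
limit of compact operators.

Necessity. The functions `log(1/(1-az))`, divided by `log(e/(1-a))^(1/p)`, are bounded in `B_p`, and
their images tend to zero at each point of the disc as `a → 1`. Compactness upgrades this to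
convergence in the norm of `X` (`tendsto_compact_testFunctions`). The inclusion of `X` in the Bloch
space is continuous (`IsSpaceOfAnalyticFunctions.exists_bloch_bound`), so `(1-a²)|C_μ(f_a)'(a)| →
0`. At the real point `a` the integrand is nonnegative, and its part over `t ≥ a` already dominates
the Carleson quotient (`measure_mul_le_norm_deriv_cesaroLike`). -/

/-! ### Circle integrals of powers of `|1 - r e^{iθ}|` -/

/-- Write `1 - z = (1 - tz) - (1 - t)z`; the correction is at most `1 - t|z| ≤ |1 - tz|`. -/
theorem norm_one_sub_le_two_mul {z : ℂ} (hz : ‖z‖ ≤ 1) {t : ℝ} (h0 : 0 ≤ t) (h1 : t ≤ 1) :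
    ‖1 - z‖ ≤ 2 * ‖1 - t * z‖ := by
  have e : 1 - z = (1 - t * z) - ((1 - t : ℝ) : ℂ) * z := by push_cast; ring
  have a : ‖1 - z‖ ≤ ‖1 - t * z‖ + (1 - t) * ‖z‖ := by
    rw [e]
    refine (norm_sub_le _ _).trans_eq ?_
    rw [norm_mul, Complex.norm_real, Real.norm_of_nonneg (by linarith)]
  have b : 1 - t * ‖z‖ ≤ ‖1 - t * z‖ := by
    have := norm_sub_norm_le (1 : ℂ) (t * z)
    rwa [norm_one, norm_mul, Complex.norm_real, Real.norm_of_nonneg h0] at this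
  nlinarith [norm_nonneg z]

/-- On the unit circle `|1 - e^{iθ}| = 2|sin(θ/2)|`, and Jordan's inequality bounds the sine below.
Moving inwards to radius `r` costs a factor 2. -/
theorem abs_le_pi_mul_norm_one_sub {r θ : ℝ} (hr0 : 0 ≤ r) (hr1 : r ≤ 1) (hθ : |θ| ≤ Real.pi) :
    |θ| ≤ Real.pi * ‖1 - r * Complex.exp (θ * Complex.I)‖ := by
  have h1 : ‖Complex.exp (θ * Complex.I)‖ ≤ 1 := (Complex.norm_exp_ofReal_mul_I θ).le
  have h2 := norm_one_sub_le_two_mul h1 hr0 hr1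
  have h3 : ‖1 - Complex.exp (θ * Complex.I)‖ = 2 * |Real.sin (θ / 2)| := by
    rw [norm_sub_rev, mul_comm, Complex.norm_exp_I_mul_ofReal_sub_one, norm_mul]
    simp
  have h4 : 2 / Real.pi * |θ / 2| ≤ |Real.sin (θ / 2)| := by
    apply Real.mul_abs_le_abs_sin
    rw [abs_div, abs_two]
    linarith
  rw [abs_div, abs_two] at h4
  have h5 : |θ| = Real.pi * (2 / Real.pi * (|θ| / 2)) := by
    field_simp
  rw [h5]
  gcongr
  linarith

theorem one_sub_add_abs_le {r θ : ℝ} (hr0 : 0 ≤ r) (hr1 : r ≤ 1) (hθ : |θ| ≤ Real.pi) :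
    1 - r + |θ| ≤ 2 * Real.pi * ‖1 - r * Complex.exp (θ * Complex.I)‖ := by
  have h1 := abs_le_pi_mul_norm_one_sub hr0 hr1 hθ
  have h2 := norm_sub_norm_le (1 : ℂ) (r * Complex.exp (θ * Complex.I))
  rw [norm_one, norm_mul, Complex.norm_exp_ofReal_mul_I, Complex.norm_real,
    Real.norm_of_nonneg hr0, mul_one] at h2
  nlinarith [Real.pi_gt_three, norm_nonneg (1 - r * Complex.exp (θ * Complex.I))]

theorem integral_add_rpow_neg_le {b δ A : ℝ} (hb : 1 < b) (hδ : 0 < δ) (hA : 0 ≤ A) :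
    ∫ x in (0 : ℝ)..A, (δ + x) ^ (-b) ≤ δ ^ (1 - b) / (b - 1) := by
  rw [intervalIntegral.integral_comp_add_left (fun x => x ^ (-b)) δ, integral_rpow]
  · rw [add_zero, show -b + 1 = -(b - 1) by ring, div_neg, ← neg_div, neg_sub,
      show 1 - b = -(b - 1) by ring]
    have : 0 ≤ (δ + A) ^ (-(b - 1)) := by positivity
    gcongr
    linarith
  · right
    refine ⟨by linarith, ?_⟩
    rw [Set.uIcc_of_le (by linarith)]
    simp [hδ]

theorem continuous_norm_one_sub_rpow {r : ℝ} (hr0 : 0 ≤ r) (hr1 : r < 1) (b : ℝ) :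
    Continuous fun θ : ℝ => ‖1 - r * Complex.exp (θ * Complex.I)‖ ^ b := by
  refine Continuous.rpow_const (by fun_prop) fun θ => Or.inl ?_
  have h2 := norm_sub_norm_le (1 : ℂ) (r * Complex.exp (θ * Complex.I))
  rw [norm_one, norm_mul, Complex.norm_exp_ofReal_mul_I, Complex.norm_real,
    Real.norm_of_nonneg hr0, mul_one] at h2
  linarith

/-- For `b > 1` the integral of `|1 - r e^{iθ}|^(-b)` over the circle is `O((1 - r)^(1 - b))`. -/
theorem exists_integral_norm_one_sub_rpow_le {b : ℝ} (hb : 1 < b) :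
    ∃ C : ℝ, 0 < C ∧ ∀ r : ℝ, 0 ≤ r → r < 1 →
      ∫ θ in (-Real.pi)..Real.pi, ‖1 - r * Complex.exp (θ * Complex.I)‖ ^ (-b) ≤
        C * (1 - r) ^ (1 - b) := by
  have hπ := Real.pi_pos
  refine ⟨(2 * Real.pi) ^ b * (2 / (b - 1)), by have : 0 < b - 1 := by linarith
                                                positivity, fun r hr0 hr1 => ?_⟩
  have hδ : 0 < 1 - r := by linarith
  have hc : Continuous fun θ : ℝ => (1 - r + |θ|) ^ (-b) :=
    Continuous.rpow_const (by fun_prop) fun θ => Or.inl (by positivity)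
  have h1 : ∫ θ in (-Real.pi)..Real.pi, ‖1 - r * Complex.exp (θ * Complex.I)‖ ^ (-b) ≤
      ∫ θ in (-Real.pi)..Real.pi, (2 * Real.pi) ^ b * (1 - r + |θ|) ^ (-b) := by
    refine intervalIntegral.integral_mono_on (by linarith)
      (continuous_norm_one_sub_rpow hr0 hr1 _).continuousOn.intervalIntegrable
      (hc.const_mul _).continuousOn.intervalIntegrable fun θ hθ => ?_
    have h := one_sub_add_abs_le hr0 hr1.le (abs_le.2 hθ)
    have hpos : 0 < 1 - r + |θ| := by positivity
    have hn : 0 < ‖1 - r * Complex.exp (θ * Complex.I)‖ := by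
      by_contra hcon
      nlinarith [norm_nonneg (1 - r * Complex.exp (θ * Complex.I))]
    have h2 := Real.rpow_le_rpow_of_nonpos hpos h (show -b ≤ 0 by linarith)
    rw [Real.mul_rpow (by positivity) hn.le] at h2
    calc ‖1 - r * Complex.exp (θ * Complex.I)‖ ^ (-b)
        = (2 * Real.pi) ^ b * ((2 * Real.pi) ^ (-b) *
          ‖1 - r * Complex.exp (θ * Complex.I)‖ ^ (-b)) := by
          rw [← mul_assoc, ← Real.rpow_add (by positivity)]
          simp
      _ ≤ _ := by gcongr
  refine h1.trans ?_
  rw [intervalIntegral.integral_const_mul, mul_assoc]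
  gcongr
  have h3 : ∫ θ in (0 : ℝ)..Real.pi, (1 - r + |θ|) ^ (-b) ≤ (1 - r) ^ (1 - b) / (b - 1) := by
    refine le_trans (le_of_eq ?_) (integral_add_rpow_neg_le hb hδ hπ.le)
    refine intervalIntegral.integral_congr fun θ hθ => ?_
    rw [Set.uIcc_of_le hπ.le] at hθ
    simp only [abs_of_nonneg hθ.1]
  have h4 : ∫ θ in (-Real.pi)..0, (1 - r + |θ|) ^ (-b) =
      ∫ θ in (0 : ℝ)..Real.pi, (1 - r + |θ|) ^ (-b) := by
    have := intervalIntegral.integral_comp_neg (a := 0) (b := Real.pi)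
      (fun θ : ℝ => (1 - r + |θ|) ^ (-b))
    simp only [abs_neg, neg_zero] at this
    exact this.symm
  rw [← intervalIntegral.integral_add_adjacent_intervals (b := 0)
    hc.continuousOn.intervalIntegrable hc.continuousOn.intervalIntegrable, h4]
  calc _ ≤ (1 - r) ^ (1 - b) / (b - 1) + (1 - r) ^ (1 - b) / (b - 1) := add_le_add h3 h3
    _ = _ := by ring

/-! ### Sub-mean value inequalities and Besov integrals along radii -/

theorem lintegral_ball_eq_polar {f : ℂ → ℝ≥0∞} (hf : Measurable f) (R : ℝ) :
    ∫⁻ w in Metric.ball (0 : ℂ) R, f w = ∫⁻ ρ in Set.Ioo 0 R, ENNReal.ofReal ρ *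
      ∫⁻ θ in Set.Ioo (-Real.pi) Real.pi, f (ρ * Complex.exp (θ * Complex.I)) := by
  have hm : Measurable fun p : ℝ × ℝ => f (p.1 * Complex.exp (p.2 * Complex.I)) :=
    hf.comp (by fun_prop)
  rw [← lintegral_indicator Metric.isOpen_ball.measurableSet,
    ← Complex.lintegral_comp_polarCoord_symm, polarCoord_target,
    Measure.volume_eq_prod, ← Measure.prod_restrict]
  have e : ∀ p : ℝ × ℝ, Complex.polarCoord.symm p = p.1 * Complex.exp (p.2 * Complex.I) := by
    intro p
    rw [Complex.polarCoord_symm_apply, Complex.exp_mul_I]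
    push_cast
    rfl
  simp only [e, smul_eq_mul]
  rw [lintegral_prod]
  · rw [← lintegral_indicator measurableSet_Ioi, ← lintegral_indicator measurableSet_Ioo]
    refine lintegral_congr fun ρ => ?_
    by_cases hρ : 0 < ρ
    · rw [Set.indicator_of_mem (by exact hρ)]
      by_cases hR : ρ < R
      · rw [Set.indicator_of_mem (by exact ⟨hρ, hR⟩), ← lintegral_const_mul]
        · refine lintegral_congr fun θ => ?_
          rw [Set.indicator_of_mem]
          simpa [abs_of_pos hρ] using hR
        · exact hm.comp (by fun_prop : Measurable fun θ : ℝ => (ρ, θ))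
      · rw [Set.indicator_of_notMem (fun h => hR h.2)]
        refine (lintegral_congr fun θ => ?_).trans lintegral_zero
        rw [Set.indicator_of_notMem, mul_zero]
        simpa [abs_of_pos hρ] using hR
    · rw [Set.indicator_of_notMem (by exact hρ), Set.indicator_of_notMem (fun h => hρ h.1)]
  · refine Measurable.aemeasurable ?_
    refine Measurable.mul (by fun_prop) ?_
    exact (hf.indicator Metric.isOpen_ball.measurableSet).comp
      (by fun_prop : Measurable fun p : ℝ × ℝ => (p.1 : ℂ) * Complex.exp (p.2 * Complex.I))

theorem two_pi_mul_enorm_le {g : ℂ → ℂ} {c : ℂ} {ρ : ℝ} (hρ : 0 ≤ ρ)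
    (hg : DiffContOnCl ℂ g (Metric.ball c ρ)) :
    ENNReal.ofReal (2 * Real.pi) * ‖g c‖ₑ ≤
      ∫⁻ θ in Set.Ioo (-Real.pi) Real.pi, ‖g (c + ρ * Complex.exp (θ * Complex.I))‖ₑ := by
  have hπ := Real.pi_pos
  have h1 : Real.circleAverage g c ρ = g c :=
    DiffContOnCl.circleAverage (by rwa [abs_of_nonneg hρ])
  have h2 := ((periodic_circleMap c ρ).comp g).intervalIntegral_add_eq 0 (-Real.pi)
  rw [zero_add, show -Real.pi + 2 * Real.pi = Real.pi by ring] at h2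
  have h3 : ((2 * Real.pi : ℝ) : ℂ) * g c = ∫ θ in (-Real.pi)..Real.pi, g (circleMap c ρ θ) := by
    rw [← h1, Real.circleAverage_def, Complex.real_smul, ← mul_assoc, ← Complex.ofReal_mul,
      mul_inv_cancel₀ (by positivity), Complex.ofReal_one, one_mul]
    exact h2
  have h4 : ENNReal.ofReal (2 * Real.pi) * ‖g c‖ₑ = ‖((2 * Real.pi : ℝ) : ℂ) * g c‖ₑ := by
    rw [enorm_mul, ← ofReal_norm (((2 * Real.pi : ℝ) : ℂ)), Complex.norm_real,
      Real.norm_of_nonneg (by positivity)]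
  rw [h4, h3, intervalIntegral.integral_of_le (by linarith), integral_Ioc_eq_integral_Ioo]
  exact enorm_integral_le_lintegral_enorm _

/-- Sub-mean value inequality over a disc. -/
theorem enorm_mul_area_le {g : ℂ → ℂ} (hm : Measurable g) {c : ℂ} {R : ℝ} (hR : 0 < R)
    (hg : DifferentiableOn ℂ g (Metric.ball c R)) :
    ENNReal.ofReal (Real.pi * R ^ 2) * ‖g c‖ₑ ≤ ∫⁻ w in Metric.ball c R, ‖g w‖ₑ := by
  have h0 : ∫⁻ w in Metric.ball c R, ‖g w‖ₑ = ∫⁻ w in Metric.ball 0 R, ‖g (c + w)‖ₑ := by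
    rw [← lintegral_indicator Metric.isOpen_ball.measurableSet,
      ← lintegral_indicator Metric.isOpen_ball.measurableSet,
      ← lintegral_add_left_eq_self _ c]
    refine lintegral_congr fun w => ?_
    simp [Set.indicator]
  rw [h0, lintegral_ball_eq_polar (f := fun w => ‖g (c + w)‖ₑ) (by fun_prop)]
  have h1 : ∫⁻ ρ in Set.Ioo 0 R, ENNReal.ofReal ρ = ENNReal.ofReal (R ^ 2 / 2) := by
    rw [← ofReal_integral_eq_lintegral_ofReal, ← integral_Ioc_eq_integral_Ioo,
      ← intervalIntegral.integral_of_le hR.le, integral_id]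
    · simp
    · exact (continuous_id.integrableOn_Icc).mono_set Set.Ioo_subset_Icc_self
    · filter_upwards [ae_restrict_mem measurableSet_Ioo] with x hx using hx.1.le
  calc ENNReal.ofReal (Real.pi * R ^ 2) * ‖g c‖ₑ
      = (∫⁻ ρ in Set.Ioo 0 R, ENNReal.ofReal ρ) * (ENNReal.ofReal (2 * Real.pi) * ‖g c‖ₑ) := by
        rw [h1, ← mul_assoc, ← ENNReal.ofReal_mul (by positivity)]
        congr 2
        ring
    _ = ∫⁻ ρ in Set.Ioo 0 R, ENNReal.ofReal ρ * (ENNReal.ofReal (2 * Real.pi) * ‖g c‖ₑ) := by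
        rw [lintegral_mul_const _ (by fun_prop)]
    _ ≤ _ := by
        refine setLIntegral_mono' measurableSet_Ioo fun ρ hρ => ?_
        gcongr
        exact two_pi_mul_enorm_le hρ.1.le
          (hg.diffContOnCl_ball (Metric.closedBall_subset_ball hρ.2))

/-- Hölder's inequality on the disc reduces this to the case of exponent 1: since `p/q = p - 1`, the
area enters to the power `p - 1` and cancels. -/
theorem enorm_rpow_mul_area_le {p q : ℝ} (hpq : p.HolderConjugate q) {g : ℂ → ℂ}
    (hm : Measurable g) {c : ℂ} {R : ℝ} (hR : 0 < R)
    (hg : DifferentiableOn ℂ g (Metric.ball c R)) :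
    ENNReal.ofReal (Real.pi * R ^ 2) * ‖g c‖ₑ ^ p ≤ ∫⁻ w in Metric.ball c R, ‖g w‖ₑ ^ p := by
  have hp := hpq.pos
  have hq := hpq.symm.pos
  have h1 := enorm_mul_area_le hm hR hg
  set a := ENNReal.ofReal (Real.pi * R ^ 2) with ha
  have ha0 : a ≠ 0 := by
    rw [ha, ENNReal.ofReal_ne_zero_iff]
    positivity
  have hat : a ≠ ∞ := ENNReal.ofReal_ne_top
  have hv : volume (Metric.ball c R) = a := by
    rw [Complex.volume_ball, ha, mul_comm, ENNReal.ofReal_mul Real.pi_pos.le,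
      ENNReal.ofReal_pow hR.le]
    congr 1
    exact (ENNReal.ofReal_coe_nnreal (p := NNReal.pi)).symm
  have h2 := ENNReal.lintegral_mul_le_Lp_mul_Lq (volume.restrict (Metric.ball c R)) hpq
    (f := fun w => ‖g w‖ₑ) (g := fun _ => 1) hm.enorm.aemeasurable aemeasurable_const
  simp only [Pi.mul_apply, mul_one, ENNReal.one_rpow, lintegral_one, Measure.restrict_apply_univ,
    hv] at h2
  have h3 : (a * ‖g c‖ₑ) ^ p ≤ (∫⁻ w in Metric.ball c R, ‖g w‖ₑ ^ p) * a ^ (p - 1) := by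
    refine (ENNReal.rpow_le_rpow (h1.trans h2) hp.le).trans_eq ?_
    rw [ENNReal.mul_rpow_of_nonneg _ _ hp.le, ← ENNReal.rpow_mul, ← ENNReal.rpow_mul,
      one_div_mul_cancel hp.ne', ENNReal.rpow_one]
    congr 2
    have := hpq.div_conj_eq_sub_one
    rw [← this]
    ring
  rw [ENNReal.mul_rpow_of_nonneg _ _ hp.le] at h3
  have h4 : a ^ p = a ^ (p - 1) * a := by
    have := ENNReal.rpow_add (p - 1) 1 ha0 hat
    rwa [sub_add_cancel, ENNReal.rpow_one] at this
  rw [h4, mul_assoc, mul_comm _ (a ^ (p - 1))] at h3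
  refine (ENNReal.mul_le_mul_iff_right ?_ ?_).1 h3
  · simp [ha0, hat]
  · exact ENNReal.rpow_ne_top_of_ne_zero ha0 hat

/-- Comparability in both directions is needed because the exponent `p - 2` of the Besov weight may
have either sign. -/
theorem rpow_le_three_rpow_abs_mul {x y : ℝ} (hx : 0 < x) (hxy : x ≤ 3 * y) (hyx : y ≤ 3 * x)
    (c : ℝ) : x ^ c ≤ 3 ^ |c| * y ^ c := by
  have hy : 0 < y := by linarith
  rcases le_total 0 c with h | h
  · rw [abs_of_nonneg h, ← Real.mul_rpow (by norm_num) hy.le]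
    gcongr
  · rw [abs_of_nonpos h]
    have h1 := Real.rpow_le_rpow_of_nonpos hy hyx h
    rw [Real.mul_rpow (by norm_num) hx.le] at h1
    calc x ^ c = 3 ^ (-c) * (3 ^ c * x ^ c) := by
          rw [← mul_assoc, ← Real.rpow_add (by norm_num)]
          simp
      _ ≤ _ := by gcongr

/-- On the disc of radius `(1-x)/2` about `xζ`, `1 - |w|²` and `1 - x` agree up to a factor 3, so
the Besov weight is essentially constant there. The factor `(1-x)⁻¹` stays inside the integral for
the later interchange in `x` and `w`. -/
theorem enorm_rpow_mul_le_lintegral_besov {p q : ℝ} (hpq : p.HolderConjugate q) {g : ℂ → ℂ}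
    (hm : Measurable g) (hg : DifferentiableOn ℂ g (Metric.ball 0 1)) {ζ : ℂ} (hζ : ‖ζ‖ = 1)
    {x : ℝ} (hx0 : 0 ≤ x) (hx1 : x < 1) :
    ‖g (x * ζ)‖ₑ ^ p * ENNReal.ofReal ((1 - x) ^ (p - 1)) ≤
      ENNReal.ofReal (4 / Real.pi * 3 ^ |p - 2|) *
        ∫⁻ w in Metric.ball (x * ζ) ((1 - x) / 2),
          ‖g w‖ₑ ^ p * ENNReal.ofReal ((1 - ‖w‖ ^ 2) ^ (p - 2)) * ENNReal.ofReal ((1 - x)⁻¹) := by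
  have hπ := Real.pi_pos
  have hd : 0 < 1 - x := by linarith
  have hn : ‖(x : ℂ) * ζ‖ = x := by rw [norm_mul, hζ, Complex.norm_real, mul_one,
    Real.norm_of_nonneg hx0]
  have hb : ∀ w ∈ Metric.ball ((x : ℂ) * ζ) ((1 - x) / 2), |‖w‖ - x| < (1 - x) / 2 := by
    intro w hw
    rw [mem_ball_iff_norm] at hw
    have := abs_norm_sub_norm_le w (x * ζ)
    rw [hn] at this
    linarith
  have h1 := enorm_rpow_mul_area_le hpq hm (by linarith : 0 < (1 - x) / 2)
    (hg.mono fun w hw => by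
      have := (abs_lt.1 (hb w hw)).2
      rw [mem_ball_zero_iff]
      linarith)
  have h2 : ENNReal.ofReal ((1 - x) ^ (p - 1)) =
      ENNReal.ofReal (Real.pi * ((1 - x) / 2) ^ 2) * ENNReal.ofReal (4 / Real.pi) *
        ENNReal.ofReal ((1 - x) ^ (p - 2)) * ENNReal.ofReal ((1 - x)⁻¹) := by
    rw [← ENNReal.ofReal_mul (by positivity), ← ENNReal.ofReal_mul (by positivity),
      ← ENNReal.ofReal_mul (by positivity)]
    congr 1
    rw [show p - 1 = (p - 2) + 1 by ring, Real.rpow_add hd, Real.rpow_one]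
    field_simp
    norm_num
  calc ‖g (x * ζ)‖ₑ ^ p * ENNReal.ofReal ((1 - x) ^ (p - 1))
      = ENNReal.ofReal (4 / Real.pi) * ((ENNReal.ofReal (Real.pi * ((1 - x) / 2) ^ 2) *
        ‖g (x * ζ)‖ₑ ^ p) * (ENNReal.ofReal ((1 - x) ^ (p - 2)) * ENNReal.ofReal ((1 - x)⁻¹))) := by
        rw [h2]; ring
    _ ≤ ENNReal.ofReal (4 / Real.pi) * ((∫⁻ w in Metric.ball ((x : ℂ) * ζ) ((1 - x) / 2),
        ‖g w‖ₑ ^ p) * (ENNReal.ofReal ((1 - x) ^ (p - 2)) * ENNReal.ofReal ((1 - x)⁻¹))) := by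
        gcongr
    _ = ENNReal.ofReal (4 / Real.pi) * ∫⁻ w in Metric.ball ((x : ℂ) * ζ) ((1 - x) / 2),
        ‖g w‖ₑ ^ p * (ENNReal.ofReal ((1 - x) ^ (p - 2)) * ENNReal.ofReal ((1 - x)⁻¹)) := by
        rw [lintegral_mul_const _ (by fun_prop)]
    _ ≤ ENNReal.ofReal (4 / Real.pi) * ∫⁻ w in Metric.ball ((x : ℂ) * ζ) ((1 - x) / 2),
        ENNReal.ofReal (3 ^ |p - 2|) * (‖g w‖ₑ ^ p * ENNReal.ofReal ((1 - ‖w‖ ^ 2) ^ (p - 2)) *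
          ENNReal.ofReal ((1 - x)⁻¹)) := by
        refine mul_le_mul_right ?_ _
        refine setLIntegral_mono' Metric.isOpen_ball.measurableSet fun w hw => ?_
        have hw' := abs_lt.1 (hb w hw)
        have h3 : ENNReal.ofReal ((1 - x) ^ (p - 2)) ≤
            ENNReal.ofReal (3 ^ |p - 2|) * ENNReal.ofReal ((1 - ‖w‖ ^ 2) ^ (p - 2)) := by
          rw [← ENNReal.ofReal_mul (by positivity)]
          refine ENNReal.ofReal_le_ofReal (rpow_le_three_rpow_abs_mul hd ?_ ?_ _)
          · nlinarith [norm_nonneg w]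
          · nlinarith [norm_nonneg w]
        calc _ ≤ ‖g w‖ₑ ^ p * ((ENNReal.ofReal (3 ^ |p - 2|) *
                ENNReal.ofReal ((1 - ‖w‖ ^ 2) ^ (p - 2))) * ENNReal.ofReal ((1 - x)⁻¹)) := by
              gcongr
          _ = _ := by ring
    _ = _ := by
        rw [lintegral_const_mul _ (by fun_prop), ← mul_assoc, ← ENNReal.ofReal_mul (by positivity)]

/-- With `d = 1 - |w|`, the discs containing `w` have `2d/3 < 1 - x < 2d`. This interval has length
`4d/3` and the integrand is at most `3/(2d)` on it, whence the factor 2. -/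
theorem lintegral_stolz_inv_le {ζ : ℂ} (hζ : ‖ζ‖ = 1) {w : ℂ} :
    ∫⁻ x in Set.Ioo (0 : ℝ) 1, {x : ℝ | w ∈ Metric.ball (x * ζ) ((1 - x) / 2)}.indicator
      (fun x => ENNReal.ofReal ((1 - x)⁻¹)) x ≤ 2 * (Metric.ball (0 : ℂ) 1).indicator 1 w := by
  have key : ∀ x ∈ Set.Ioo (0 : ℝ) 1, w ∈ Metric.ball (x * ζ) ((1 - x) / 2) →
      |‖w‖ - x| < (1 - x) / 2 := by
    intro x hx hw
    rw [mem_ball_iff_norm] at hw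
    have := abs_norm_sub_norm_le w (x * ζ)
    rw [norm_mul, hζ, Complex.norm_real, mul_one, Real.norm_of_nonneg hx.1.le] at this
    linarith
  by_cases hw : w ∈ Metric.ball (0 : ℂ) 1
  · have hd : 0 < 1 - ‖w‖ := by linarith [mem_ball_zero_iff.1 hw]
    set d := 1 - ‖w‖ with hdd
    rw [Set.indicator_of_mem hw, Pi.one_apply, mul_one]
    calc _ ≤ ∫⁻ x in Set.Ioo (0 : ℝ) 1, (Set.Ioo (1 - 2 * d) (1 - 2 * d / 3)).indicator
          (fun x => ENNReal.ofReal (3 / (2 * d))) x := by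
          refine setLIntegral_mono' measurableSet_Ioo fun x hx => ?_
          by_cases hx' : w ∈ Metric.ball (x * ζ) ((1 - x) / 2)
          · have h := abs_lt.1 (key x hx hx')
            rw [Set.indicator_of_mem (by exact hx'),
              Set.indicator_of_mem (show x ∈ Set.Ioo (1 - 2 * d) (1 - 2 * d / 3) from
                ⟨by linarith, by linarith⟩)]
            refine ENNReal.ofReal_le_ofReal ?_
            rw [inv_le_comm₀ (by linarith [hx.2]) (by positivity), inv_div]
            linarith
          · rw [Set.indicator_of_notMem (by exact hx')]
            exact zero_le
      _ ≤ ∫⁻ x, (Set.Ioo (1 - 2 * d) (1 - 2 * d / 3)).indicator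
          (fun x => ENNReal.ofReal (3 / (2 * d))) x := setLIntegral_le_lintegral _ _
      _ = 2 := by
          rw [lintegral_indicator measurableSet_Ioo, setLIntegral_const, Real.volume_Ioo,
            ← ENNReal.ofReal_mul (by positivity)]
          rw [show 3 / (2 * d) * (1 - 2 * d / 3 - (1 - 2 * d)) = 2 by field_simp; ring]
          simp
  · rw [Set.indicator_of_notMem hw, mul_zero, nonpos_iff_eq_zero]
    rw [mem_ball_zero_iff, not_lt] at hw
    rw [setLIntegral_congr_fun (g := 0) measurableSet_Ioo]
    · simp
    · intro x hx
      refine Set.indicator_of_notMem (fun h => ?_) _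
      have := (abs_lt.1 (key x hx h)).2
      linarith [hx.2]

/-- Along a radius, `∫ |g(xζ)|^p (1 - x)^(p-1) dx` is controlled by the Besov integral. -/
theorem lintegral_radius_le {p q : ℝ} (hpq : p.HolderConjugate q) {g : ℂ → ℂ}
    (hm : Measurable g) (hg : DifferentiableOn ℂ g (Metric.ball 0 1)) {ζ : ℂ} (hζ : ‖ζ‖ = 1) :
    ∫⁻ x in Set.Ioo (0 : ℝ) 1, ‖g (x * ζ)‖ₑ ^ p * ENNReal.ofReal ((1 - x) ^ (p - 1)) ≤
      ENNReal.ofReal (4 / Real.pi * 3 ^ |p - 2|) * (2 * ∫⁻ w in Metric.ball (0 : ℂ) 1,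
        ‖g w‖ₑ ^ p * ENNReal.ofReal ((1 - ‖w‖ ^ 2) ^ (p - 2))) := by
  set H : ℂ → ℝ≥0∞ := fun w => ‖g w‖ₑ ^ p * ENNReal.ofReal ((1 - ‖w‖ ^ 2) ^ (p - 2)) with hH
  have hHm : Measurable H := (hm.enorm.pow_const p).mul (measurable_besovWeight p)
  set S : Set (ℝ × ℂ) := {y | y.2 ∈ Metric.ball (y.1 * ζ) ((1 - y.1) / 2)} with hS
  have hSm : MeasurableSet S := by
    refine (isOpen_lt (f := fun y : ℝ × ℂ => dist y.2 (y.1 * ζ)) (g := fun y => (1 - y.1) / 2)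
      ?_ ?_).measurableSet <;> fun_prop
  calc _ ≤ ∫⁻ x in Set.Ioo (0 : ℝ) 1, ENNReal.ofReal (4 / Real.pi * 3 ^ |p - 2|) *
        ∫⁻ w, S.indicator (fun y => H y.2 * ENNReal.ofReal ((1 - y.1)⁻¹)) (x, w) := by
        refine setLIntegral_mono' measurableSet_Ioo fun x hx => ?_
        refine (enorm_rpow_mul_le_lintegral_besov hpq hm hg hζ hx.1.le hx.2).trans_eq ?_
        rw [← lintegral_indicator Metric.isOpen_ball.measurableSet]
        rfl
    _ = ENNReal.ofReal (4 / Real.pi * 3 ^ |p - 2|) * ∫⁻ x in Set.Ioo (0 : ℝ) 1,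
        ∫⁻ w, S.indicator (fun y => H y.2 * ENNReal.ofReal ((1 - y.1)⁻¹)) (x, w) := by
        rw [lintegral_const_mul' _ _ ENNReal.ofReal_ne_top]
    -- By Tonelli, integrating in `x` first leaves a bounded overlap count for each `w`.
    _ = ENNReal.ofReal (4 / Real.pi * 3 ^ |p - 2|) * ∫⁻ w, ∫⁻ x in Set.Ioo (0 : ℝ) 1,
        S.indicator (fun y => H y.2 * ENNReal.ofReal ((1 - y.1)⁻¹)) (x, w) := by
        rw [lintegral_lintegral_swap]
        refine Measurable.aemeasurable (Measurable.indicator ?_ hSm)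
        exact (hHm.comp measurable_snd).mul (by fun_prop)
    _ ≤ ENNReal.ofReal (4 / Real.pi * 3 ^ |p - 2|) * ∫⁻ w,
        2 * (Metric.ball (0 : ℂ) 1).indicator H w := by
        gcongr with w
        calc _ = ∫⁻ x in Set.Ioo (0 : ℝ) 1, H w *
              {x : ℝ | w ∈ Metric.ball (x * ζ) ((1 - x) / 2)}.indicator
                (fun x => ENNReal.ofReal ((1 - x)⁻¹)) x := by
              refine lintegral_congr fun x => ?_
              by_cases hx : (x, w) ∈ S
              · rw [Set.indicator_of_mem hx, Set.indicator_of_mem (by exact hx)]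
              · rw [Set.indicator_of_notMem hx, Set.indicator_of_notMem (by exact hx), mul_zero]
          _ = H w * ∫⁻ x in Set.Ioo (0 : ℝ) 1,
              {x : ℝ | w ∈ Metric.ball (x * ζ) ((1 - x) / 2)}.indicator
                (fun x => ENNReal.ofReal ((1 - x)⁻¹)) x := by
              refine lintegral_const_mul _ (Measurable.indicator (by fun_prop) ?_)
              exact hSm.preimage (by fun_prop : Measurable fun x : ℝ => (x, w))
          _ ≤ H w * (2 * (Metric.ball (0 : ℂ) 1).indicator 1 w) := by
              gcongr
              exact lintegral_stolz_inv_le hζ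
          _ = _ := by
              simp only [Set.indicator]
              split_ifs <;> simp [mul_comm]
    _ = _ := by
        rw [lintegral_const_mul _ (hHm.indicator Metric.isOpen_ball.measurableSet),
          lintegral_indicator Metric.isOpen_ball.measurableSet]

theorem integral_inv_one_sub_eq {r : ℝ} (hr : r < 1) (hr0 : 0 ≤ r) :
    ∫⁻ x in Set.Ioc 0 r, ENNReal.ofReal ((1 - x)⁻¹) = ENNReal.ofReal (-Real.log (1 - r)) := by
  have hc : ContinuousOn (fun x : ℝ => (1 - x)⁻¹) (Set.Icc 0 r) :=
    ContinuousOn.inv₀ (by fun_prop) fun x hx => by linarith [hx.2]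
  rw [← ofReal_integral_eq_lintegral_ofReal, ← intervalIntegral.integral_of_le hr0]
  · congr 1
    rw [intervalIntegral.integral_comp_sub_left (fun x => x⁻¹) 1, integral_inv]
    · simp
    · rw [Set.uIcc_of_le (by linarith)]
      simp [hr]
  · exact hc.integrableOn_Icc.mono_set Set.Ioc_subset_Icc_self
  · filter_upwards [ae_restrict_mem measurableSet_Ioc] with x hx
    have : 0 < 1 - x := by linarith [hx.2]
    positivity

theorem enorm_sub_le_lintegral_radius {f : ℂ → ℂ}
    (hf : DifferentiableOn ℂ f (Metric.ball 0 1)) {ζ : ℂ} (hζ : ‖ζ‖ = 1) {r : ℝ} (hr0 : 0 ≤ r)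
    (hr : r < 1) : ‖f (r * ζ) - f 0‖ₑ ≤ ∫⁻ x in Set.Ioc 0 r, ‖deriv f (x * ζ)‖ₑ := by
  have hb : ∀ x ∈ Set.uIcc 0 r, (x : ℂ) * ζ ∈ Metric.ball (0 : ℂ) 1 := by
    intro x hx
    rw [Set.uIcc_of_le hr0] at hx
    rw [mem_ball_zero_iff, norm_mul, hζ, Complex.norm_real, mul_one, Real.norm_of_nonneg hx.1]
    linarith [hx.2]
  have hd : ∀ x ∈ Set.uIcc 0 r,
      HasDerivAt (fun x : ℝ => f (x * ζ)) (deriv f (x * ζ) * ζ) x := by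
    intro x hx
    have h1 := (hf.differentiableAt (Metric.isOpen_ball.mem_nhds (hb x hx))).hasDerivAt
    have h2 : HasDerivAt (fun x : ℝ => (x : ℂ) * ζ) ζ x := by
      simpa using (Complex.ofRealCLM.hasDerivAt (x := x)).mul_const ζ
    exact h1.comp x h2
  have hc : ContinuousOn (fun x : ℝ => deriv f (x * ζ) * ζ) (Set.uIcc 0 r) :=
    ((hf.deriv Metric.isOpen_ball).continuousOn.comp (by fun_prop) hb).mul continuousOn_const
  have h := intervalIntegral.integral_eq_sub_of_hasDerivAt hd hc.intervalIntegrable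
  simp only [Complex.ofReal_zero, zero_mul] at h
  rw [← h, intervalIntegral.integral_of_le hr0]
  refine (enorm_integral_le_lintegral_enorm _).trans_eq (lintegral_congr fun x => ?_)
  rw [enorm_mul, ← ofReal_norm ζ, hζ, ENNReal.ofReal_one, mul_one]

/-- Hölder's inequality along the radius, after inserting `(1-x)^(1/q) (1-x)^(-1/q)`: as `p/q = p -
1`, the first factor is the radial Besov integral and the second is `∫ dx/(1-x)`, which yields the
logarithm. -/
theorem enorm_sub_le_besov {p q : ℝ} (hpq : p.HolderConjugate q) {f : ℂ → ℂ}
    (hf : DifferentiableOn ℂ f (Metric.ball 0 1)) {ζ : ℂ} (hζ : ‖ζ‖ = 1) {r : ℝ} (hr0 : 0 ≤ r)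
    (hr : r < 1) :
    ‖f (r * ζ) - f 0‖ₑ ≤ (ENNReal.ofReal (4 / Real.pi * 3 ^ |p - 2|) * (2 *
      ∫⁻ w in Metric.ball (0 : ℂ) 1,
        ‖deriv f w‖ₑ ^ p * ENNReal.ofReal ((1 - ‖w‖ ^ 2) ^ (p - 2)))) ^ (1 / p) *
      ENNReal.ofReal (-Real.log (1 - r)) ^ (1 / q) := by
  have hp := hpq.pos
  have hq := hpq.symm.pos
  have hm : Measurable (deriv f) := measurable_deriv f
  calc ‖f (r * ζ) - f 0‖ₑ ≤ ∫⁻ x in Set.Ioc 0 r, ‖deriv f (x * ζ)‖ₑ :=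
        enorm_sub_le_lintegral_radius hf hζ hr0 hr
    _ = ∫⁻ x in Set.Ioc 0 r, ((fun x : ℝ => ‖deriv f (x * ζ)‖ₑ *
          ENNReal.ofReal ((1 - x) ^ (1 / q))) *
        fun x : ℝ => ENNReal.ofReal ((1 - x) ^ (-(1 / q)))) x := by
        refine setLIntegral_congr_fun measurableSet_Ioc fun x hx => ?_
        have hx1 : 0 < 1 - x := by linarith [hx.2]
        simp only [Pi.mul_apply]
        rw [mul_assoc, ← ENNReal.ofReal_mul (by positivity), ← Real.rpow_add hx1]
        simp
    _ ≤ (∫⁻ x in Set.Ioc 0 r, (‖deriv f (x * ζ)‖ₑ *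
          ENNReal.ofReal ((1 - x) ^ (1 / q))) ^ p) ^ (1 / p) *
        (∫⁻ x in Set.Ioc 0 r, ENNReal.ofReal ((1 - x) ^ (-(1 / q))) ^ q) ^ (1 / q) := by
        refine ENNReal.lintegral_mul_le_Lp_mul_Lq _ hpq ?_ ?_
        · exact Measurable.aemeasurable (by fun_prop)
        · exact Measurable.aemeasurable (by fun_prop)
    _ ≤ _ := by
        gcongr ?_ ^ (1 / p) * ?_ ^ (1 / q)
        · refine le_trans ?_ (lintegral_radius_le hpq hm (hf.deriv Metric.isOpen_ball) hζ)
          refine le_trans (le_of_eq ?_)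
            (lintegral_mono_set (s := Set.Ioc 0 r) fun x hx => ⟨hx.1, hx.2.trans_lt hr⟩)
          refine setLIntegral_congr_fun measurableSet_Ioc fun x hx => ?_
          have hx1 : 0 < 1 - x := by linarith [hx.2]
          rw [ENNReal.mul_rpow_of_nonneg _ _ hp.le, ENNReal.ofReal_rpow_of_nonneg (by positivity)
            hp.le, ← Real.rpow_mul hx1.le, ← hpq.div_conj_eq_sub_one]
          congr 3
          ring
        · rw [← integral_inv_one_sub_eq hr hr0]
          refine (setLIntegral_congr_fun measurableSet_Ioc fun x hx => ?_).le
          have hx1 : 0 < 1 - x := by linarith [hx.2]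
          rw [ENNReal.ofReal_rpow_of_nonneg (by positivity) hq.le, ← Real.rpow_mul hx1.le,
            neg_mul, one_div_mul_cancel hq.ne', Real.rpow_neg_one]

theorem lintegral_besov_eq {p : ℝ} (hp : 0 < p) (f : ℂ → ℂ) :
    ∫⁻ w in Metric.ball (0 : ℂ) 1,
        ‖deriv f w‖ₑ ^ p * ENNReal.ofReal ((1 - ‖w‖ ^ 2) ^ (p - 2)) =
      ENNReal.ofReal Real.pi * besovSeminorm p f ^ p := by
  unfold besovSeminorm areaMeasure
  rw [← ENNReal.rpow_mul, one_div_mul_cancel hp.ne', ENNReal.rpow_one, Measure.restrict_smul,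
    lintegral_smul_measure, smul_eq_mul, ← mul_assoc, ← ENNReal.ofReal_mul Real.pi_pos.le,
    mul_inv_cancel₀ Real.pi_ne_zero, ENNReal.ofReal_one, one_mul]

/-! ### Logarithmic growth of Besov functions -/

/-- The logarithmic weight `log (e / (1 - r))`. -/
noncomputable def logWeight (r : ℝ) : ℝ := 1 - Real.log (1 - r)

theorem log_exp_one_div {t : ℝ} (ht : t < 1) : Real.log (Real.exp 1 / (1 - t)) = logWeight t := by
  rw [Real.log_div (Real.exp_ne_zero _) (by linarith), Real.log_exp, logWeight]

theorem one_le_logWeight {r : ℝ} (h0 : 0 ≤ r) (h1 : r < 1) : 1 ≤ logWeight r := by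
  have := Real.log_nonpos (by linarith : 0 ≤ 1 - r) (by linarith)
  unfold logWeight
  linarith

theorem logWeight_le_logWeight {r t : ℝ} (h : r ≤ t) (ht : t < 1) :
    logWeight r ≤ logWeight t := by
  have := Real.log_le_log (by linarith : 0 < 1 - t) (by linarith : 1 - t ≤ 1 - r)
  unfold logWeight
  linarith

/-- Halving the distance to 1 adds at most `log 2 < 1` to the weight, and the weight is at least 1.
-/
theorem logWeight_le_two_mul {r t : ℝ} (hr0 : 0 ≤ r) (hr : r < 1) (h : 1 - r ≤ 2 * (1 - t)) :
    logWeight t ≤ 2 * logWeight r := by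
  have h1 := Real.log_le_log (by linarith) h
  rw [Real.log_mul (by norm_num) (by linarith)] at h1
  have := one_le_logWeight hr0 hr
  have h2 : Real.log 2 < 1 := by linarith [Real.log_two_lt_d9]
  unfold logWeight at *
  linarith

/-- Growth of functions in the Besov space: `|f(z)| = O(log(e / (1 - |z|))^(1/q))`. -/
theorem Besov.exists_norm_apply_le {p q : ℝ} [Fact (1 < p)] (hpq : p.HolderConjugate q) :
    ∃ C : ℝ, 0 < C ∧ ∀ f : Besov p, ∀ z : ℂ, ‖z‖ < 1 →
      ‖(toHol f : ℂ → ℂ) z‖ ≤ C * ‖f‖ * logWeight ‖z‖ ^ (1 / q) := by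
  have hp := hpq.pos
  have hq := hpq.symm.pos
  have hπ := Real.pi_pos
  set K : ℝ := 4 / Real.pi * 3 ^ |p - 2| * (2 * Real.pi) with hK
  have hK0 : 0 ≤ K := by positivity
  -- The summand 1 accounts for `f(0)`, the other for the radial increment `f(z) - f(0)`.
  refine ⟨1 + K ^ (1 / p), by positivity, fun f z hz => ?_⟩
  set F : ℂ → ℂ := (toHol f : ℂ → ℂ) with hF
  obtain ⟨ζ, hζ, hzζ⟩ : ∃ ζ : ℂ, ‖ζ‖ = 1 ∧ (‖z‖ : ℂ) * ζ = z := by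
    refine ⟨Complex.exp (z.arg * Complex.I), Complex.norm_exp_ofReal_mul_I _, ?_⟩
    exact Complex.norm_mul_exp_arg_mul_I z
  have h1 := enorm_sub_le_besov hpq (toHol f).2.1 hζ (norm_nonneg z) hz
  rw [lintegral_besov_eq hp, hzζ] at h1
  have hS : besovSeminorm p F = ENNReal.ofReal (besovSeminorm p F).toReal :=
    (ENNReal.ofReal_toReal (besovSeminorm_ne_top f)).symm
  set S := (besovSeminorm p F).toReal with hSd
  have hS0 : 0 ≤ S := ENNReal.toReal_nonneg
  have hlog : 0 ≤ -Real.log (1 - ‖z‖) := by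
    have := one_le_logWeight (norm_nonneg z) hz
    unfold logWeight at this
    linarith
  have h2 : ‖F z - F 0‖ ≤ K ^ (1 / p) * S * (-Real.log (1 - ‖z‖)) ^ (1 / q) := by
    rw [← ENNReal.ofReal_le_ofReal_iff (by positivity), ofReal_norm]
    refine h1.trans_eq ?_
    rw [hS, ENNReal.ofReal_rpow_of_nonneg hS0 hp.le, show (2 : ℝ≥0∞) = ENNReal.ofReal 2 by simp,
      ← ENNReal.ofReal_mul hπ.le, ← ENNReal.ofReal_mul (by norm_num),
      ← ENNReal.ofReal_mul (by positivity), ENNReal.ofReal_rpow_of_nonneg (by positivity)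
      (by positivity), ENNReal.ofReal_rpow_of_nonneg hlog (by positivity),
      ← ENNReal.ofReal_mul (by positivity)]
    congr 2
    rw [show 4 / Real.pi * 3 ^ |p - 2| * (2 * (Real.pi * S ^ p)) = K * S ^ p by rw [hK]; ring,
      Real.mul_rpow hK0 (by positivity), ← Real.rpow_mul hS0, mul_one_div_cancel hp.ne',
      Real.rpow_one]
  have hL := one_le_logWeight (norm_nonneg z) hz
  have h3 : (-Real.log (1 - ‖z‖)) ^ (1 / q) ≤ logWeight ‖z‖ ^ (1 / q) := by
    refine Real.rpow_le_rpow hlog ?_ (by positivity)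
    unfold logWeight
    linarith
  have h4 : 1 ≤ logWeight ‖z‖ ^ (1 / q) := Real.one_le_rpow hL (by positivity)
  have hn : ‖f‖ = ‖F 0‖ + S := norm_def f
  calc ‖F z‖ ≤ ‖F 0‖ + ‖F z - F 0‖ := by
        have := norm_add_le (F 0) (F z - F 0)
        rwa [add_sub_cancel] at this
    _ ≤ ‖f‖ * logWeight ‖z‖ ^ (1 / q) + K ^ (1 / p) * ‖f‖ * logWeight ‖z‖ ^ (1 / q) := by
        have h5 : ‖F 0‖ ≤ ‖f‖ := by linarith
        have h6 : S ≤ ‖f‖ := by linarith [norm_nonneg (F 0)]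
        refine add_le_add ?_ (h2.trans (by gcongr))
        nlinarith [norm_nonneg f]
    _ = _ := by ring

/-! ### Integral representation of the Cesàro-like operator and its derivative -/

theorem differentiableOn_div_one_sub {f : ℂ → ℂ} (hf : DifferentiableOn ℂ f (Metric.ball 0 1)) :
    DifferentiableOn ℂ (fun z => f z / (1 - z)) (Metric.ball 0 1) := by
  refine hf.div (by fun_prop) fun z hz h => ?_
  rw [mem_ball_zero_iff, ← sub_eq_zero.1 h] at hz
  simp at hz

/-- Cauchy's estimate on the circle of radius `(1-|w|)/2` about `w`: there the logarithmic weight at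
most doubles and `|1 - z|` is at least `|1 - w|/2`. -/
theorem norm_deriv_div_one_sub_le {f : ℂ → ℂ} (hf : DifferentiableOn ℂ f (Metric.ball 0 1))
    {β K : ℝ} (hβ : 0 ≤ β) (hK : 0 ≤ K)
    (h : ∀ z : ℂ, ‖z‖ < 1 → ‖f z‖ ≤ K * logWeight ‖z‖ ^ β) {w : ℂ} (hw : ‖w‖ < 1) :
    ‖deriv (fun z => f z / (1 - z)) w‖ ≤
      4 * 2 ^ β * K * (logWeight ‖w‖ ^ β / ((1 - ‖w‖) * ‖1 - w‖)) := by
  set R := (1 - ‖w‖) / 2 with hR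
  have hR0 : 0 < R := by linarith
  have h1w : 1 - ‖w‖ ≤ ‖1 - w‖ := by
    have := norm_sub_norm_le (1 : ℂ) w
    rwa [norm_one] at this
  have hw0 : 0 < ‖1 - w‖ := by linarith
  have hL := one_le_logWeight (norm_nonneg w) hw
  have hball : Metric.closedBall w R ⊆ Metric.ball 0 1 := by
    intro z hz
    rw [mem_closedBall_iff_norm] at hz
    have := norm_sub_norm_le z w
    rw [mem_ball_zero_iff]
    linarith
  have key := Complex.norm_deriv_le_of_forall_mem_sphere_norm_le (f := fun z => f z / (1 - z))
    (C := K * (2 * logWeight ‖w‖) ^ β / (‖1 - w‖ / 2)) hR0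
    ((differentiableOn_div_one_sub hf).diffContOnCl_ball hball) ?_
  · refine key.trans_eq ?_
    rw [Real.mul_rpow (by norm_num) (by linarith), hR]
    field_simp
    norm_num
  · intro z hz
    rw [mem_sphere_iff_norm] at hz
    have hz1 := abs_le.1 (abs_norm_sub_norm_le z w)
    have hz2 : ‖z‖ < 1 := by linarith
    have h1z : ‖1 - w‖ / 2 ≤ ‖1 - z‖ := by
      have := norm_sub_norm_le (1 - w) (z - w)
      rw [show 1 - w - (z - w) = 1 - z by ring] at this
      linarith
    have hLz := one_le_logWeight (norm_nonneg z) hz2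
    rw [norm_div]
    refine div_le_div₀ (by positivity) ((h z hz2).trans ?_) (by positivity) h1z
    gcongr
    exact logWeight_le_two_mul (norm_nonneg w) hw (by linarith)

/-- The partial sums `∑_{k ≤ n} a_k` of the Taylor coefficients. -/
noncomputable def taylorPartialSum (f : ℂ → ℂ) (n : ℕ) : ℂ :=
  ∑ k ∈ Finset.range (n + 1), taylorCoeff0 f k

theorem hasSum_taylorCoeff0 {f : ℂ → ℂ} (hf : DifferentiableOn ℂ f (Metric.ball 0 1)) {w : ℂ}
    (hw : ‖w‖ < 1) : HasSum (fun n => taylorCoeff0 f n * w ^ n) (f w) := by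
  have := Complex.hasSum_taylorSeries_on_ball (r := 1) (c := 0) hf
    (z := w) (by simpa using hw)
  refine this.congr_fun fun n => ?_
  simp only [taylorCoeff0, sub_zero, smul_eq_mul]
  ring

theorem summable_norm_taylorCoeff0 {f : ℂ → ℂ} (hf : DifferentiableOn ℂ f (Metric.ball 0 1))
    {w : ℂ} (hw : ‖w‖ < 1) : Summable fun n => ‖taylorCoeff0 f n * w ^ n‖ :=
  (hasSum_taylorCoeff0 hf hw).summable.norm

theorem taylorPartialSum_mul_pow (f : ℂ → ℂ) (w : ℂ) (n : ℕ) :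
    ∑ k ∈ Finset.range (n + 1), taylorCoeff0 f k * w ^ k * w ^ (n - k) =
      taylorPartialSum f n * w ^ n := by
  rw [taylorPartialSum, Finset.sum_mul]
  refine Finset.sum_congr rfl fun k hk => ?_
  rw [mul_assoc, ← pow_add, Nat.add_sub_cancel' (Nat.lt_succ_iff.1 (Finset.mem_range.1 hk))]

theorem summable_norm_taylorPartialSum {f : ℂ → ℂ}
    (hf : DifferentiableOn ℂ f (Metric.ball 0 1)) {w : ℂ} (hw : ‖w‖ < 1) :
    Summable fun n => ‖taylorPartialSum f n * w ^ n‖ := by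
  have := summable_norm_sum_mul_range_of_summable_norm (summable_norm_taylorCoeff0 hf hw)
    (summable_norm_geometric_of_norm_lt_one hw)
  simpa only [taylorPartialSum_mul_pow] using this

/-- Cauchy product with the geometric series: dividing by `1 - w` replaces coefficients by their
partial sums. -/
theorem hasSum_taylorPartialSum {f : ℂ → ℂ} (hf : DifferentiableOn ℂ f (Metric.ball 0 1)) {w : ℂ}
    (hw : ‖w‖ < 1) : HasSum (fun n => taylorPartialSum f n * w ^ n) (f w / (1 - w)) := by
  have h := tsum_mul_tsum_eq_tsum_sum_range_of_summable_norm (summable_norm_taylorCoeff0 hf hw)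
    (summable_norm_geometric_of_norm_lt_one hw)
  rw [(hasSum_taylorCoeff0 hf hw).tsum_eq, tsum_geometric_of_norm_lt_one hw] at h
  simp only [taylorPartialSum_mul_pow] at h
  rw [div_eq_mul_inv, h]
  exact (summable_norm_taylorPartialSum hf hw).of_norm.hasSum

theorem norm_Ico_mul_le (t : Set.Ico (0 : ℝ) 1) (z : ℂ) : ‖((t : ℝ) : ℂ) * z‖ ≤ ‖z‖ := by
  rw [norm_mul, Complex.norm_real, Real.norm_of_nonneg t.2.1]
  exact mul_le_of_le_one_left (norm_nonneg z) t.2.2.le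

section Cesaro

variable (μ : Measure (Set.Ico (0 : ℝ) 1)) [IsFiniteMeasure μ]

/-- Expand the integrand in powers of `tz` and integrate term by term, so that `∫ t^n dμ` produces
the moments. The terms are dominated by their values at `t = 1`, which are summable. -/
theorem hasSum_cesaroLike {f : ℂ → ℂ} (hf : DifferentiableOn ℂ f (Metric.ball 0 1)) {z : ℂ}
    (hz : ‖z‖ < 1) : HasSum (fun n => (moment01 μ n : ℂ) * taylorPartialSum f n * z ^ n)
      (∫ t, f ((t : ℝ) * z) / (1 - (t : ℝ) * z) ∂μ) := by
  have h := hasSum_integral_of_summable_integral_norm (μ := μ)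
    (F := fun (n : ℕ) (t : Set.Ico (0 : ℝ) 1) => taylorPartialSum f n * ((t : ℝ) * z) ^ n) ?_ ?_
  · have e : ∀ t : Set.Ico (0 : ℝ) 1, ∑' n, taylorPartialSum f n * ((t : ℝ) * z) ^ n =
        f ((t : ℝ) * z) / (1 - (t : ℝ) * z) := fun t =>
      (hasSum_taylorPartialSum hf ((norm_Ico_mul_le t z).trans_lt hz)).tsum_eq
    simp only [e] at h
    refine h.congr_fun fun n => ?_
    have e2 : ∀ t : Set.Ico (0 : ℝ) 1, taylorPartialSum f n * ((t : ℝ) * z) ^ n =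
        (((t : ℝ) ^ n : ℝ) : ℂ) * (taylorPartialSum f n * z ^ n) := fun t => by
      push_cast
      ring
    simp only [e2]
    rw [integral_mul_const, integral_complex_ofReal, moment01]
    ring
  · intro n
    refine Integrable.of_bound (C := ‖taylorPartialSum f n * z ^ n‖) ?_ (ae_of_all _ fun t => ?_)
    · exact Continuous.aestronglyMeasurable (by fun_prop)
    · rw [norm_mul, norm_mul, norm_pow, norm_pow]
      gcongr
      exact norm_Ico_mul_le t z
  · refine Summable.of_nonneg_of_le (fun n => integral_nonneg fun t => norm_nonneg _) (fun n => ?_)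
      ((summable_norm_taylorPartialSum hf hz).mul_left (μ.real Set.univ))
    have := norm_integral_le_of_norm_le_const (μ := μ) (C := ‖taylorPartialSum f n * z ^ n‖)
      (f := fun t : Set.Ico (0 : ℝ) 1 => ‖taylorPartialSum f n * ((t : ℝ) * z) ^ n‖)
      (ae_of_all _ fun t => by
        rw [norm_norm, norm_mul, norm_mul, norm_pow, norm_pow]
        gcongr
        exact norm_Ico_mul_le t z)
    rw [mul_comm]
    exact (le_abs_self _).trans this

theorem cesaroLike_eq_integral (f : HolDisc) {z : ℂ} (hz : ‖z‖ < 1) :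
    cesaroLike μ f z = ∫ t, (f : ℂ → ℂ) ((t : ℝ) * z) / (1 - (t : ℝ) * z) ∂μ := by
  rw [cesaroLike, Set.indicator_of_mem (by simpa using hz)]
  exact (hasSum_cesaroLike μ f.2.1 hz).tsum_eq

theorem continuous_comp_Ico_mul {g : ℂ → ℂ} (hg : ContinuousOn g (Metric.ball 0 1)) {z : ℂ}
    (hz : ‖z‖ < 1) : Continuous fun t : Set.Ico (0 : ℝ) 1 => g ((t : ℝ) * z) := by
  refine hg.comp_continuous (by fun_prop) fun t => ?_
  rw [mem_ball_zero_iff]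
  exact (norm_Ico_mul_le t z).trans_lt hz

theorem integrable_comp_Ico_mul {g : ℂ → ℂ} (hg : ContinuousOn g (Metric.ball 0 1)) {z : ℂ}
    (hz : ‖z‖ < 1) : Integrable (fun t : Set.Ico (0 : ℝ) 1 => g ((t : ℝ) * z)) μ := by
  obtain ⟨B, hB⟩ := (isCompact_closedBall (0 : ℂ) ‖z‖).exists_bound_of_continuousOn
    (hg.mono (Metric.closedBall_subset_ball hz))
  refine Integrable.of_bound (C := B) (continuous_comp_Ico_mul hg hz).aestronglyMeasurable
    (ae_of_all _ fun t => hB _ ?_)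
  rw [mem_closedBall_zero_iff]
  exact norm_Ico_mul_le t z

/-- Differentiation under the integral: for `w` in a disc of radius `R < 1`, all points `tw` stay in
it, so a bound for `g'` on the closed disc dominates. -/
theorem hasDerivAt_integral_comp_Ico_mul {g : ℂ → ℂ}
    (hg : DifferentiableOn ℂ g (Metric.ball 0 1)) {z : ℂ} (hz : ‖z‖ < 1) :
    HasDerivAt (fun z : ℂ => ∫ t : Set.Ico (0 : ℝ) 1, g ((t : ℝ) * z) ∂μ)
      (∫ t : Set.Ico (0 : ℝ) 1, ((t : ℝ) : ℂ) * deriv g ((t : ℝ) * z) ∂μ) z := by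
  obtain ⟨R, hzR, hR⟩ := exists_between hz
  have hg' := (hg.deriv Metric.isOpen_ball).continuousOn
  obtain ⟨B, hB⟩ := (isCompact_closedBall (0 : ℂ) R).exists_bound_of_continuousOn
    (hg'.mono (Metric.closedBall_subset_ball hR))
  refine (hasDerivAt_integral_of_dominated_loc_of_deriv_le (s := Metric.ball 0 R)
    (bound := fun _ => B) (F' := fun w (t : Set.Ico (0 : ℝ) 1) =>
      ((t : ℝ) : ℂ) * deriv g ((t : ℝ) * w)) ?_ ?_ ?_ ?_ ?_ ?_ ?_).2
  · exact Metric.isOpen_ball.mem_nhds (by simpa using hzR)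
  · filter_upwards [Metric.isOpen_ball.mem_nhds (show z ∈ Metric.ball 0 1 by simpa using hz)]
      with w hw
    exact (continuous_comp_Ico_mul hg.continuousOn (by simpa using hw)).aestronglyMeasurable
  · exact integrable_comp_Ico_mul μ hg.continuousOn hz
  · exact (Continuous.mul (by fun_prop) (continuous_comp_Ico_mul hg' hz)).aestronglyMeasurable
  · refine ae_of_all _ fun t w hw => ?_
    rw [norm_mul, Complex.norm_real, Real.norm_of_nonneg t.2.1]
    rw [mem_ball_zero_iff] at hw
    have := hB (t * w) (by
      rw [mem_closedBall_zero_iff]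
      exact (norm_Ico_mul_le t w).trans hw.le)
    exact (mul_le_of_le_one_left (norm_nonneg _) t.2.2.le).trans this
  · exact integrable_const B
  · refine ae_of_all _ fun t w hw => ?_
    rw [mem_ball_zero_iff] at hw
    have hm : (t : ℝ) * w ∈ Metric.ball (0 : ℂ) 1 := by
      rw [mem_ball_zero_iff]
      exact (norm_Ico_mul_le t w).trans_lt (hw.trans hR)
    have h1 := (hg.differentiableAt (Metric.isOpen_ball.mem_nhds hm)).hasDerivAt
    have h2 : HasDerivAt (fun w : ℂ => ((t : ℝ) : ℂ) * w) ((t : ℝ) : ℂ) w := by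
      simpa using (hasDerivAt_id w).const_mul ((t : ℝ) : ℂ)
    have := h1.comp w h2
    rwa [mul_comm] at this

theorem hasDerivAt_cesaroLike (f : HolDisc) {z : ℂ} (hz : ‖z‖ < 1) :
    HasDerivAt (cesaroLike μ f) (∫ t : Set.Ico (0 : ℝ) 1, ((t : ℝ) : ℂ) *
      deriv (fun w => (f : ℂ → ℂ) w / (1 - w)) ((t : ℝ) * z) ∂μ) z := by
  refine (hasDerivAt_integral_comp_Ico_mul μ (differentiableOn_div_one_sub f.2.1)
    hz).congr_of_eventuallyEq ?_
  filter_upwards [Metric.isOpen_ball.mem_nhds (show z ∈ Metric.ball 0 1 by simpa using hz)]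
    with w hw
  exact cesaroLike_eq_integral μ f (by simpa using hw)

/-- The Cesàro-like operator on `H(𝔻)`. -/
noncomputable def cesaroHol (f : HolDisc) : HolDisc :=
  ⟨cesaroLike μ f, fun _ hz => (hasDerivAt_cesaroLike μ f
      (by simpa using hz)).differentiableAt.differentiableWithinAt,
    fun _ hz => Set.indicator_of_notMem hz _⟩

theorem coe_cesaroHol (f : HolDisc) : (cesaroHol μ f : ℂ → ℂ) = cesaroLike μ f := rfl

end Cesaro

/-! ### Integrals against logarithmic Carleson measures -/

/-- The graph of the convex function `u ↦ u^(-ε)` lies above its tangent at `x`. -/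
theorem rpow_neg_sub_rpow_neg_ge {ε x y : ℝ} (hε : 0 < ε) (hx : 0 < x) (hy : 0 < y) :
    ε * (x - y) * x ^ (-(1 + ε)) ≤ y ^ (-ε) - x ^ (-ε) := by
  have h1 : 1 + ε * (1 - y / x) ≤ (y / x) ^ (-ε) := by
    rw [Real.rpow_def_of_pos (by positivity)]
    have h2 := Real.add_one_le_exp (Real.log (y / x) * -ε)
    have h3 := Real.log_le_sub_one_of_pos (show 0 < y / x by positivity)
    nlinarith
  rw [Real.div_rpow hy.le hx.le] at h1
  have hxp : 0 < x ^ (-ε) := by positivity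
  have h4 : x ^ (-(1 + ε)) = x ^ (-ε) / x := by
    rw [neg_add, add_comm, Real.rpow_add hx, Real.rpow_neg_one]
    rfl
  rw [le_div_iff₀ hxp] at h1
  have h5 : ε * (x - y) * x ^ (-(1 + ε)) = ε * (1 - y / x) * x ^ (-ε) := by
    rw [h4]
    field_simp
  rw [h5]
  linarith

/-- A dyadic Riemann sum for `∫ (u + δ)^(-1-ε) du`. The tangent inequality bounds each term by a
difference of values of `(u + δ)^(-ε)`, and these telescope; the 4 arises since `2^(-k) = 4(2^(-k-1)
- 2^(-k-2))`. -/
theorem sum_range_pow_mul_rpow_le {ε δ : ℝ} (hε : 0 < ε) (hδ : 0 < δ) (N : ℕ) :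
    ∑ k ∈ Finset.range N, (1 / 2 : ℝ) ^ k * ((1 / 2) ^ (k + 1) + δ) ^ (-(1 + ε)) ≤
      4 / ε * δ ^ (-ε) := by
  have h : ∀ k : ℕ, (1 / 2 : ℝ) ^ k * ((1 / 2) ^ (k + 1) + δ) ^ (-(1 + ε)) ≤
      4 / ε * (((1 / 2) ^ (k + 1 + 1) + δ) ^ (-ε) - ((1 / 2) ^ (k + 1) + δ) ^ (-ε)) := by
    intro k
    have h1 := rpow_neg_sub_rpow_neg_ge hε (show 0 < (1 / 2 : ℝ) ^ (k + 1) + δ by positivity)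
      (show 0 < (1 / 2 : ℝ) ^ (k + 1 + 1) + δ by positivity)
    calc _ = 4 / ε * (ε * ((1 / 2 : ℝ) ^ (k + 1) + δ - ((1 / 2) ^ (k + 1 + 1) + δ)) *
          ((1 / 2) ^ (k + 1) + δ) ^ (-(1 + ε))) := by
          rw [pow_succ _ (k + 1), pow_succ _ k]
          field_simp
          ring
      _ ≤ _ := by gcongr
  refine (Finset.sum_le_sum fun k _ => h k).trans ?_
  rw [← Finset.mul_sum,
    Finset.sum_range_sub (fun k => ((1 / 2 : ℝ) ^ (k + 1) + δ) ^ (-ε)) N]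
  have h2 : ((1 / 2 : ℝ) ^ (N + 1) + δ) ^ (-ε) ≤ δ ^ (-ε) :=
    Real.rpow_le_rpow_of_nonpos hδ (by linarith [show (0 : ℝ) < (1 / 2) ^ (N + 1) by positivity])
      (by linarith)
  have h3 : 0 < ((1 / 2 : ℝ) ^ (0 + 1) + δ) ^ (-ε) := by positivity
  gcongr
  linarith

/-- `M` bounds the logarithmic Carleson quotients of `μ`. -/
def LogCarlesonBound (β M : ℝ) (μ : Measure (Set.Ico (0 : ℝ) 1)) : Prop :=
  ∀ t : ℝ, 0 ≤ t → t < 1 → (μ {x | t ≤ (x : ℝ)}).toReal * logWeight t ^ β ≤ M * (1 - t)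

/-- Dyadic decomposition towards 1. Choosing `k` with `2^(-k-1) < 1 - t ≤ 2^(-k)` bounds the
integrand by a constant `c k` on the tail `1 - 2^(-k) ≤ t`. The Carleson condition cancels the
logarithm against the mass of that tail and leaves `M 2^(-k)`, which is summable by
`sum_range_pow_mul_rpow_le`. -/
theorem LogCarlesonBound.lintegral_le {β M ε : ℝ} {μ : Measure (Set.Ico (0 : ℝ) 1)}
    [IsFiniteMeasure μ] (h : LogCarlesonBound β M μ) (hβ : 0 ≤ β) (hM : 0 ≤ M) (hε : 0 < ε)
    {r : ℝ} (hr0 : 0 ≤ r) (hr1 : r < 1) :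
    ∫⁻ t : Set.Ico (0 : ℝ) 1,
        ENNReal.ofReal (logWeight (t * r) ^ β * (1 - t * r) ^ (-(1 + ε))) ∂μ ≤
      ENNReal.ofReal (2 ^ β * 2 ^ (1 + ε) * (4 / ε) * M * (1 - r) ^ (-ε)) := by
  have hδ : 0 < 1 - r := by linarith
  set c : ℕ → ℝ := fun k => (2 * logWeight (1 - (1 / 2) ^ k)) ^ β *
    (2 ^ (1 + ε) * ((1 / 2) ^ (k + 1) + (1 - r)) ^ (-(1 + ε))) with hc
  set S : ℕ → Set (Set.Ico (0 : ℝ) 1) := fun k => {x | 1 - (1 / 2) ^ k ≤ (x : ℝ)} with hS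
  have hSm : ∀ k, MeasurableSet (S k) := fun k =>
    measurableSet_le measurable_const measurable_subtype_coe
  have ht0 : ∀ k : ℕ, 0 ≤ 1 - (1 / 2 : ℝ) ^ k := fun k => by
    have : (1 / 2 : ℝ) ^ k ≤ 1 := pow_le_one₀ (by norm_num) (by norm_num)
    linarith
  have ht1 : ∀ k : ℕ, 1 - (1 / 2 : ℝ) ^ k < 1 := fun k => by
    have : 0 < (1 / 2 : ℝ) ^ k := by positivity
    linarith
  have hLk : ∀ k : ℕ, 1 ≤ logWeight (1 - (1 / 2) ^ k) := fun k => one_le_logWeight (ht0 k) (ht1 k)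
  have hpt : ∀ t : Set.Ico (0 : ℝ) 1,
      ENNReal.ofReal (logWeight (t * r) ^ β * (1 - t * r) ^ (-(1 + ε))) ≤
        ∑' k, (S k).indicator (fun _ => ENNReal.ofReal (c k)) t := by
    intro t
    have h0 := t.2.1
    have h1 := t.2.2
    obtain ⟨k, hk1, hk2⟩ := exists_nat_pow_near_of_lt_one (show 0 < 1 - (t : ℝ) by linarith)
      (by linarith) (show (0 : ℝ) < 1 / 2 by norm_num) (by norm_num)
    have hmem : t ∈ S k := by
      change 1 - (1 / 2) ^ k ≤ (t : ℝ)
      linarith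
    have htr : (t : ℝ) * r ≤ t := mul_le_of_le_one_right h0 hr1.le
    refine le_trans ?_ (ENNReal.le_tsum k)
    rw [Set.indicator_of_mem hmem]
    refine ENNReal.ofReal_le_ofReal ?_
    have hL1 : 1 ≤ logWeight (t * r) := one_le_logWeight (by positivity) (by linarith)
    have hL2 : logWeight (t * r) ≤ 2 * logWeight (1 - (1 / 2) ^ k) :=
      (logWeight_le_logWeight htr h1).trans
        (logWeight_le_two_mul (ht0 k) (ht1 k) (by rw [pow_succ] at hk1; linarith))
    -- Both `1 - t` and `1 - r` are at most `1 - tr`. Keeping `1 - r` here is what makes the final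
    -- bound a power of it.
    have hx : (1 / 2) ^ (k + 1) + (1 - r) ≤ 2 * (1 - t * r) := by nlinarith
    have hx0 : 0 < (1 / 2 : ℝ) ^ (k + 1) + (1 - r) := by positivity
    have h3 : (1 - t * r) ^ (-(1 + ε)) ≤
        2 ^ (1 + ε) * ((1 / 2) ^ (k + 1) + (1 - r)) ^ (-(1 + ε)) := by
      have := Real.rpow_le_rpow_of_nonpos hx0 hx (show -(1 + ε) ≤ 0 by linarith)
      rw [Real.mul_rpow (by norm_num) (by linarith)] at this
      calc (1 - t * r) ^ (-(1 + ε)) =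
            2 ^ (1 + ε) * (2 ^ (-(1 + ε)) * (1 - t * r) ^ (-(1 + ε))) := by
            rw [← mul_assoc, ← Real.rpow_add (by norm_num)]
            simp
        _ ≤ _ := by gcongr
    have : 0 ≤ 1 - t * r := by linarith
    exact mul_le_mul (Real.rpow_le_rpow (by linarith) hL2 hβ) h3 (by positivity)
      (Real.rpow_nonneg (by linarith [hLk k]) _)
  have hterm : ∀ k, ENNReal.ofReal (c k) * μ (S k) ≤ ENNReal.ofReal (2 ^ β * 2 ^ (1 + ε) * M *
      ((1 / 2 : ℝ) ^ k * ((1 / 2) ^ (k + 1) + (1 - r)) ^ (-(1 + ε)))) := by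
    intro k
    have hLp : 0 < logWeight (1 - (1 / 2) ^ k) ^ β := Real.rpow_pos_of_pos (by linarith [hLk k]) _
    have hc0 : 0 ≤ c k := mul_nonneg (Real.rpow_nonneg (by linarith [hLk k]) _) (by positivity)
    rw [← ENNReal.ofReal_toReal (measure_ne_top μ (S k)), ← ENNReal.ofReal_mul hc0]
    refine ENNReal.ofReal_le_ofReal ?_
    have h1 := h _ (ht0 k) (ht1 k)
    rw [sub_sub_cancel] at h1
    calc c k * (μ (S k)).toReal = 2 ^ β * 2 ^ (1 + ε) *
          ((1 / 2) ^ (k + 1) + (1 - r)) ^ (-(1 + ε)) *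
            ((μ (S k)).toReal * logWeight (1 - (1 / 2) ^ k) ^ β) := by
          rw [hc]
          simp only
          rw [Real.mul_rpow (by norm_num) (by linarith [hLk k])]
          ring
      _ ≤ 2 ^ β * 2 ^ (1 + ε) * ((1 / 2) ^ (k + 1) + (1 - r)) ^ (-(1 + ε)) *
          (M * (1 / 2) ^ k) := by gcongr
      _ = _ := by ring
  calc _ ≤ ∫⁻ t, ∑' k, (S k).indicator (fun _ => ENNReal.ofReal (c k)) t ∂μ :=
        lintegral_mono hpt
    _ = ∑' k, ENNReal.ofReal (c k) * μ (S k) := by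
        rw [lintegral_tsum fun k => (measurable_const.indicator (hSm k)).aemeasurable]
        congr 1
        ext k
        rw [lintegral_indicator (hSm k), setLIntegral_const]
    _ ≤ _ := by
        refine ENNReal.tsum_le_of_sum_range_le fun N => (Finset.sum_le_sum fun k _ =>
          hterm k).trans ?_
        rw [← ENNReal.ofReal_sum_of_nonneg fun k _ => by positivity, ← Finset.mul_sum]
        refine ENNReal.ofReal_le_ofReal ?_
        calc _ ≤ 2 ^ β * 2 ^ (1 + ε) * M * (4 / ε * (1 - r) ^ (-ε)) := by
              gcongr
              exact sum_range_pow_mul_rpow_le hε hδ N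
          _ = _ := by ring

/-- The pointwise estimate for `C_μ(f)'` under a logarithmic Carleson condition. -/
theorem exists_norm_deriv_cesaroLike_le {β ε : ℝ} (hβ : 0 ≤ β) (hε : 0 < ε) (hε1 : ε ≤ 1) :
    ∃ C : ℝ, 0 < C ∧ ∀ (μ : Measure (Set.Ico (0 : ℝ) 1)) [IsFiniteMeasure μ] (M K : ℝ)
      (f : HolDisc), LogCarlesonBound β M μ → 0 ≤ M → 0 ≤ K →
      (∀ z : ℂ, ‖z‖ < 1 → ‖(f : ℂ → ℂ) z‖ ≤ K * logWeight ‖z‖ ^ β) → ∀ z : ℂ, ‖z‖ < 1 →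
        ‖deriv (cesaroLike μ f) z‖ ≤
          C * M * K * (‖1 - z‖ ^ (-(1 - ε)) * (1 - ‖z‖) ^ (-ε)) := by
  refine ⟨4 * 2 ^ β * 2 ^ (1 - ε) * (2 ^ β * 2 ^ (1 + ε) * (4 / ε)), by positivity,
    fun μ _ M K f hμ hM hK hf z hz => ?_⟩
  rw [(hasDerivAt_cesaroLike μ f hz).deriv]
  have hz0 : 0 < ‖1 - z‖ := by
    have := norm_sub_norm_le (1 : ℂ) z
    rw [norm_one] at this
    linarith
  have hz1 : 0 < 1 - ‖z‖ := by linarith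
  set D := 4 * 2 ^ β * K * (2 ^ (1 - ε) * ‖1 - z‖ ^ (-(1 - ε))) with hD
  have hD0 : 0 ≤ D := by positivity
  have hpt : ∀ t : Set.Ico (0 : ℝ) 1, ‖((t : ℝ) : ℂ) *
      deriv (fun w => (f : ℂ → ℂ) w / (1 - w)) ((t : ℝ) * z)‖ₑ ≤ ENNReal.ofReal D *
        ENNReal.ofReal (logWeight (t * ‖z‖) ^ β * (1 - t * ‖z‖) ^ (-(1 + ε))) := by
    intro t
    have h0 := t.2.1
    have h1 := t.2.2
    have htz : ‖((t : ℝ) : ℂ) * z‖ = t * ‖z‖ := by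
      rw [norm_mul, Complex.norm_real, Real.norm_of_nonneg h0]
    have htz1 : t * ‖z‖ < 1 := htz ▸ (norm_Ico_mul_le t z).trans_lt hz
    have hu : 0 < 1 - t * ‖z‖ := by linarith
    have hL := one_le_logWeight (by positivity : 0 ≤ t * ‖z‖) htz1
    have hd := norm_deriv_div_one_sub_le f.2.1 hβ hK hf (w := (t : ℝ) * z) (by rwa [htz])
    rw [htz] at hd
    have hv1 : 1 - t * ‖z‖ ≤ ‖1 - (t : ℝ) * z‖ := by
      have := norm_sub_norm_le (1 : ℂ) ((t : ℝ) * z)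
      rwa [norm_one, htz] at this
    have hv2 := norm_one_sub_le_two_mul hz.le h0 h1.le
    set v := ‖1 - (t : ℝ) * z‖ with hv
    have hv0 : 0 < v := by linarith
    rw [← ENNReal.ofReal_mul hD0, ← ofReal_norm]
    refine ENNReal.ofReal_le_ofReal ?_
    rw [norm_mul, Complex.norm_real, Real.norm_of_nonneg h0]
    refine (mul_le_of_le_one_left (norm_nonneg _) h1.le).trans (hd.trans ?_)
    -- Splitting `1/|1 - tz|` is the key device: the power `ε` is spent on the radial factor,
    -- raising its exponent to `1 + ε` so that the integral in `t` is a pure power; the power `1 -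
    -- ε` retains the singularity at `z = 1`, independent of `t`.
    have e1 : v⁻¹ ≤ (1 - t * ‖z‖) ^ (-ε) * (2 ^ (1 - ε) * ‖1 - z‖ ^ (-(1 - ε))) := by
      have e2 : v⁻¹ = v ^ (-ε) * v ^ (-(1 - ε)) := by
        rw [← Real.rpow_add hv0, ← Real.rpow_neg_one]
        congr 1
        ring
      have e3 : v ^ (-ε) ≤ (1 - t * ‖z‖) ^ (-ε) :=
        Real.rpow_le_rpow_of_nonpos hu hv1 (by linarith)
      have e4 : v ^ (-(1 - ε)) ≤ (‖1 - z‖ / 2) ^ (-(1 - ε)) :=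
        Real.rpow_le_rpow_of_nonpos (by positivity) (by linarith) (by linarith)
      rw [Real.div_rpow hz0.le (by norm_num), Real.rpow_neg (by norm_num : (0 : ℝ) ≤ 2),
        div_inv_eq_mul, mul_comm (‖1 - z‖ ^ _)] at e4
      rw [e2]
      gcongr
    have e5 : (1 - t * ‖z‖) ^ (-(1 + ε)) = (1 - t * ‖z‖)⁻¹ * (1 - t * ‖z‖) ^ (-ε) := by
      rw [neg_add, Real.rpow_add hu, Real.rpow_neg_one]
    rw [e5, div_eq_mul_inv, mul_inv]
    calc _ ≤ 4 * 2 ^ β * K * (logWeight (t * ‖z‖) ^ β * ((1 - t * ‖z‖)⁻¹ *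
          ((1 - t * ‖z‖) ^ (-ε) * (2 ^ (1 - ε) * ‖1 - z‖ ^ (-(1 - ε)))))) := by gcongr
      _ = _ := by rw [hD]; ring
  rw [← ENNReal.ofReal_le_ofReal_iff (by positivity), ofReal_norm]
  calc _ ≤ ∫⁻ t : Set.Ico (0 : ℝ) 1, ENNReal.ofReal D *
        ENNReal.ofReal (logWeight (t * ‖z‖) ^ β * (1 - t * ‖z‖) ^ (-(1 + ε))) ∂μ :=
        (enorm_integral_le_lintegral_enorm _).trans (lintegral_mono hpt)
    _ ≤ ENNReal.ofReal D *
        ENNReal.ofReal (2 ^ β * 2 ^ (1 + ε) * (4 / ε) * M * (1 - ‖z‖) ^ (-ε)) := by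
        rw [lintegral_const_mul' _ _ ENNReal.ofReal_ne_top]
        gcongr
        exact hμ.lintegral_le hβ hM hε (norm_nonneg z) hz
    _ = _ := by
        rw [← ENNReal.ofReal_mul hD0]
        congr 1
        rw [hD]
        ring

/-! ### Functions whose derivative has a controlled singularity at 1 -/

theorem HolDisc.ext_of_ball {f g : HolDisc}
    (h : ∀ z : ℂ, ‖z‖ < 1 → (f : ℂ → ℂ) z = (g : ℂ → ℂ) z) : f = g := by
  ext z
  by_cases hz : z ∈ Metric.ball (0 : ℂ) 1
  · exact h z (by simpa using hz)
  · rw [f.2.2 z hz, g.2.2 z hz]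

/-- The growth condition `|g'(z)| ≤ K |1 - z|^(ε-1) (1 - |z|)^(-ε)`, together with
`|g(0)| ≤ K`. -/
def SingularBound (ε K : ℝ) (g : ℂ → ℂ) : Prop :=
  ‖g 0‖ ≤ K ∧ ∀ z : ℂ, ‖z‖ < 1 →
    ‖deriv g z‖ ≤ K * (‖1 - z‖ ^ (-(1 - ε)) * (1 - ‖z‖) ^ (-ε))

theorem one_sub_norm_le_norm_one_sub (z : ℂ) : 1 - ‖z‖ ≤ ‖1 - z‖ := by
  have := norm_sub_norm_le (1 : ℂ) z
  rwa [norm_one] at this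

theorem singularWeight_le {ε : ℝ} (hε1 : ε ≤ 1) {z : ℂ} (hz : ‖z‖ < 1) :
    ‖1 - z‖ ^ (-(1 - ε)) * (1 - ‖z‖) ^ (-ε) ≤ (1 - ‖z‖)⁻¹ := by
  have hz1 : 0 < 1 - ‖z‖ := by linarith
  calc _ ≤ (1 - ‖z‖) ^ (-(1 - ε)) * (1 - ‖z‖) ^ (-ε) := by
        refine mul_le_mul_of_nonneg_right ?_ (by positivity)
        exact Real.rpow_le_rpow_of_nonpos hz1 (one_sub_norm_le_norm_one_sub z) (by linarith)
    _ = _ := by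
        rw [← Real.rpow_add hz1, ← Real.rpow_neg_one]
        congr 1
        ring

theorem SingularBound.mono {ε K K' : ℝ} {g : ℂ → ℂ} (h : SingularBound ε K g) (hK : K ≤ K') :
    SingularBound ε K' g := by
  refine ⟨h.1.trans hK, fun z hz => (h.2 z hz).trans ?_⟩
  have : 0 < 1 - ‖z‖ := by linarith
  gcongr

theorem SingularBound.smul {ε K : ℝ} {g : HolDisc} (h : SingularBound ε K g) (c : ℂ) :
    SingularBound ε (‖c‖ * K) (c • g : HolDisc) := by
  refine ⟨?_, fun z hz => ?_⟩
  · change ‖c * (g : ℂ → ℂ) 0‖ ≤ _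
    rw [norm_mul]
    exact mul_le_mul_of_nonneg_left h.1 (norm_nonneg c)
  · have e : deriv ((c • g : HolDisc) : ℂ → ℂ) z = c • deriv (g : ℂ → ℂ) z :=
      deriv_const_smul c (HolDisc_differentiableAt g (by simpa using hz))
    rw [e, norm_smul, mul_assoc]
    exact mul_le_mul_of_nonneg_left (h.2 z hz) (norm_nonneg c)

theorem SingularBound.norm_apply_le {ε : ℝ} (hε1 : ε ≤ 1) {g : HolDisc}
    (h : SingularBound ε 1 g) {R : ℝ} (hR1 : R < 1) {z : ℂ} (hz : ‖z‖ ≤ R) :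
    ‖(g : ℂ → ℂ) z‖ ≤ 1 + (1 - R)⁻¹ := by
  have hR0 : 0 ≤ R := (norm_nonneg z).trans hz
  have hp : 0 < 1 - R := by linarith
  have h1 := (convex_closedBall (0 : ℂ) R).norm_image_sub_le_of_norm_deriv_le
    (f := (g : ℂ → ℂ)) (C := (1 - R)⁻¹) (x := 0) (y := z)
    (fun w hw => HolDisc_differentiableAt g (Metric.closedBall_subset_ball hR1 hw))
    (fun w hw => ?_) (by simpa using hR0) (by simpa using hz)
  · have h2 := norm_add_le ((g : ℂ → ℂ) 0) ((g : ℂ → ℂ) z - (g : ℂ → ℂ) 0)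
    rw [add_sub_cancel] at h2
    refine h2.trans (add_le_add h.1 (h1.trans ?_))
    rw [sub_zero]
    exact mul_le_of_le_one_right (by positivity) (by linarith)
  · have hw' : ‖w‖ ≤ R := by simpa using hw
    have hw1 : ‖w‖ < 1 := hw'.trans_lt hR1
    refine (h.2 w hw1).trans ?_
    rw [one_mul]
    refine (singularWeight_le hε1 hw1).trans ?_
    gcongr

/-- The uniform bound of `SingularBound.norm_apply_le` on smaller discs makes the series converge
locally uniformly, so it may be differentiated termwise and the constants add up. This allows
synthesis from `ℓ¹` coefficients. -/
theorem SingularBound.exists_hasSum {ε : ℝ} (hε1 : ε ≤ 1) {I : Type*}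
    {g : I → HolDisc} (hg : ∀ i, SingularBound ε 1 (g i)) {c : I → ℂ}
    (hc : Summable fun i => ‖c i‖) :
    ∃ G : HolDisc, SingularBound ε (∑' i, ‖c i‖) G ∧
      ∀ z : ℂ, ‖z‖ < 1 → HasSum (fun i => c i * (g i : ℂ → ℂ) z) ((G : ℂ → ℂ) z) := by
  set F : I → ℂ → ℂ := fun i z => c i * (g i : ℂ → ℂ) z with hF
  have hbd : ∀ R : ℝ, R < 1 → ∀ i, ∀ z ∈ Metric.ball (0 : ℂ) R,
      ‖F i z‖ ≤ ‖c i‖ * (1 + (1 - R)⁻¹) := by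
    intro R hR i z hz
    rw [hF, norm_mul]
    exact mul_le_mul_of_nonneg_left ((hg i).norm_apply_le hε1 hR (mem_ball_zero_iff.1 hz).le)
      (norm_nonneg _)
  have hdF : ∀ R : ℝ, R < 1 → ∀ i, DifferentiableOn ℂ (F i) (Metric.ball 0 R) := fun R hR i =>
    ((g i).2.1.mono (Metric.ball_subset_ball hR.le)).const_mul _
  have hdiff : ∀ z : ℂ, ‖z‖ < 1 → DifferentiableAt ℂ (fun w => ∑' i, F i w) z := by
    intro z hz
    obtain ⟨R, hzR, hR⟩ := exists_between hz
    exact (Complex.differentiableOn_tsum_of_summable_norm (hc.mul_right (1 + (1 - R)⁻¹))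
      (hdF R hR) Metric.isOpen_ball (hbd R hR)).differentiableAt
      (Metric.isOpen_ball.mem_nhds (by simpa using hzR))
  have hderiv : ∀ z : ℂ, ‖z‖ < 1 →
      HasSum (fun i => deriv (F i) z) (deriv (fun w => ∑' i, F i w) z) := by
    intro z hz
    obtain ⟨R, hzR, hR⟩ := exists_between hz
    exact Complex.hasSum_deriv_of_summable_norm (hc.mul_right (1 + (1 - R)⁻¹))
      (hdF R hR) Metric.isOpen_ball (hbd R hR) (by simpa using hzR)
  have hsum : ∀ z : ℂ, ‖z‖ < 1 → HasSum (fun i => F i z) (∑' i, F i z) := by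
    intro z hz
    obtain ⟨R, hzR, hR⟩ := exists_between hz
    exact (Summable.of_norm_bounded (hc.mul_right (1 + (1 - R)⁻¹))
      fun i => hbd R hR i z (by simpa using hzR)).hasSum
  set G : ℂ → ℂ := (Metric.ball (0 : ℂ) 1).indicator fun w => ∑' i, F i w with hG
  have hGz : ∀ z : ℂ, ‖z‖ < 1 → G z = ∑' i, F i z := fun z hz =>
    Set.indicator_of_mem (by simpa using hz) _
  have hGe : ∀ z : ℂ, ‖z‖ < 1 → G =ᶠ[𝓝 z] fun w => ∑' i, F i w := by
    intro z hz
    filter_upwards [Metric.isOpen_ball.mem_nhds (show z ∈ Metric.ball 0 1 by simpa using hz)]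
      with w hw
    exact hGz w (by simpa using hw)
  refine ⟨⟨G, fun z hz => ?_, fun z hz => Set.indicator_of_notMem hz _⟩, ⟨?_, fun z hz => ?_⟩,
    fun z hz => ?_⟩
  · have hz' : ‖z‖ < 1 := by simpa using hz
    exact ((hdiff z hz').congr_of_eventuallyEq (hGe z hz')).differentiableWithinAt
  · change ‖G 0‖ ≤ _
    rw [hGz 0 (by simp)]
    refine tsum_of_norm_bounded hc.hasSum fun i => ?_
    rw [hF, norm_mul]
    exact mul_le_of_le_one_right (norm_nonneg _) (hg i).1
  · change ‖deriv G z‖ ≤ _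
    rw [(hGe z hz).deriv_eq, ← (hderiv z hz).tsum_eq]
    refine tsum_of_norm_bounded (hc.hasSum.mul_right _) fun i => ?_
    have e : deriv (F i) z = c i * deriv (g i : ℂ → ℂ) z :=
      deriv_const_mul _ (HolDisc_differentiableAt (g i) (by simpa using hz))
    rw [e, norm_mul]
    refine mul_le_mul_of_nonneg_left ?_ (norm_nonneg _)
    simpa using (hg i).2 z hz
  · change HasSum _ (G z)
    rw [hGz z hz]
    exact hsum z hz

/-! ### Norm control in `X` from the closed graph theorem -/

section Space

variable {X : Type*} [NormedAddCommGroup X] [NormedSpace ℂ X] {ι : X →ₗ[ℂ] HolDisc}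

theorem IsSpaceOfAnalyticFunctions.ext (hX : IsSpaceOfAnalyticFunctions ι) {x y : X}
    (h : ∀ z : ℂ, ‖z‖ < 1 → (ι x : ℂ → ℂ) z = (ι y : ℂ → ℂ) z) : x = y :=
  hX.injective (HolDisc.ext_of_ball h)

theorem IsSpaceOfAnalyticFunctions.tendsto_eval (hX : IsSpaceOfAnalyticFunctions ι) {z : ℂ}
    (hz : ‖z‖ < 1) {α : Type*} {l : Filter α} {u : α → X} {x : X} (hu : Tendsto u l (𝓝 x)) :
    Tendsto (fun a => (ι (u a) : ℂ → ℂ) z) l (𝓝 ((ι x : ℂ → ℂ) z)) :=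
  ((hX.continuous_eval z (by simpa using hz)).tendsto x).comp hu

/-- A closed graph argument: if `X` contains all functions satisfying a `SingularBound`, then it
does so with control of the norms. -/
theorem IsSpaceOfAnalyticFunctions.exists_norm_le [CompleteSpace X]
    (hX : IsSpaceOfAnalyticFunctions ι) {ε : ℝ} (hε1 : ε ≤ 1)
    (hr : ∀ (g : HolDisc) (K : ℝ), SingularBound ε K g → g ∈ Set.range ι) :
    ∃ C : ℝ, 0 < C ∧ ∀ (x : X) (K : ℝ), 0 ≤ K → SingularBound ε K (ι x) → ‖x‖ ≤ C * K := by
  -- The elements of `X` with constant 1 serve as an index set. The synthesis map `c ↦ ∑ c_i i` from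
  -- `ℓ¹(I)` to `X` will be bounded, and unit vectors are sent to the elements themselves, so these
  -- are uniformly bounded in norm.
  let I := {x : X // SingularBound ε 1 (ι x)}
  have hsn : ∀ c : lp (fun _ : I => ℂ) 1, Summable fun i => ‖c i‖ := fun c => by
    simpa using (lp.memℓp c).summable (by simp)
  have hnorm : ∀ c : lp (fun _ : I => ℂ) 1, ‖c‖ = ∑' i, ‖c i‖ := fun c => by
    simpa using lp.norm_eq_tsum_rpow (by simp) c
  have hex : ∀ c : lp (fun _ : I => ℂ) 1, ∃ x : X, ∀ z : ℂ, ‖z‖ < 1 →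
      HasSum (fun i : I => c i * (ι i.1 : ℂ → ℂ) z) ((ι x : ℂ → ℂ) z) := by
    intro c
    obtain ⟨G, hG, hG2⟩ := SingularBound.exists_hasSum hε1 (g := fun i : I => ι i.1)
      (fun i => i.2) (hsn c)
    obtain ⟨x, rfl⟩ := hr G _ hG
    exact ⟨x, hG2⟩
  choose Λ hΛ using hex
  let L : lp (fun _ : I => ℂ) 1 →ₗ[ℂ] X :=
    { toFun := Λ
      map_add' := fun c d => hX.ext fun z hz => by
        have h1 := hΛ (c + d) z hz
        have h2 := (hΛ c z hz).add (hΛ d z hz)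
        rw [map_add]
        refine h1.unique (h2.congr_fun fun i => ?_)
        rw [lp.coeFn_add, Pi.add_apply, add_mul]
      map_smul' := fun a c => hX.ext fun z hz => by
        have h1 := hΛ (a • c) z hz
        have h2 := (hΛ c z hz).mul_left a
        rw [RingHom.id_apply, map_smul]
        refine h1.unique (h2.congr_fun fun i => ?_)
        rw [lp.coeFn_smul, Pi.smul_apply, smul_eq_mul, mul_assoc] }
  have hL : ∀ c, L c = Λ c := fun _ => rfl
  have hcont : Continuous L := by
    -- Limits in `X` are identified pointwise: evaluation at `z` is continuous on `X`, and the
    -- synthesized value at `z` is `ℓ¹`-continuous in the coefficients.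
    refine L.continuous_of_seq_closed_graph fun u c y hu hy => hX.ext fun z hz => ?_
    have h1 := hX.tendsto_eval hz hy
    refine tendsto_nhds_unique h1 ?_
    rw [tendsto_iff_norm_sub_tendsto_zero] at hu ⊢
    have h2 := hu.mul_const (1 + (1 - ‖z‖)⁻¹)
    rw [zero_mul] at h2
    refine squeeze_zero (fun n => norm_nonneg _) (fun n => ?_) h2
    have h3 := hΛ (u n - c) z hz
    have h4 : (ι (L (u n)) : ℂ → ℂ) z - (ι (L c) : ℂ → ℂ) z = (ι (Λ (u n - c)) : ℂ → ℂ) z := by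
      rw [← hL, map_sub, map_sub]
      rfl
    rw [Function.comp_apply, h4, ← h3.tsum_eq, hnorm]
    refine tsum_of_norm_bounded ((hsn (u n - c)).hasSum.mul_right _) fun i => ?_
    rw [norm_mul]
    exact mul_le_mul_of_nonneg_left (i.2.norm_apply_le hε1 hz le_rfl) (norm_nonneg _)
  obtain ⟨C, hC0, hC⟩ := (⟨L, hcont⟩ : lp (fun _ : I => ℂ) 1 →L[ℂ] X).bound
  have hunit : ∀ i : I, ‖i.1‖ ≤ C := by
    classical
    intro i
    have h1 : L (lp.single 1 i (1 : ℂ)) = i.1 := by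
      refine hX.ext fun z hz => ?_
      refine (hΛ (lp.single 1 i (1 : ℂ)) z hz).unique ?_
      have h2 := hasSum_single (f := fun j : I => (lp.single 1 i (1 : ℂ) : I → ℂ) j *
        (ι j.1 : ℂ → ℂ) z) i fun j hj => by
          rw [lp.single_apply_ne _ _ _ hj, zero_mul]
      rwa [lp.single_apply_self, one_mul] at h2
    have h2 := hC (lp.single 1 i (1 : ℂ))
    rw [lp.norm_single (by simp), norm_one, mul_one] at h2
    rw [← h1]
    exact h2
  have hpos : ∀ (x : X) (K : ℝ), 0 < K → SingularBound ε K (ι x) → ‖x‖ ≤ C * K := by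
    intro x K hK hx
    have h1 : SingularBound ε 1 (ι ((K⁻¹ : ℂ) • x)) := by
      have := hx.smul (K⁻¹ : ℂ)
      rwa [norm_inv, Complex.norm_real, Real.norm_of_nonneg hK.le, inv_mul_cancel₀ hK.ne',
        ← map_smul] at this
    have h2 := hunit ⟨_, h1⟩
    rw [norm_smul, norm_inv, Complex.norm_real, Real.norm_of_nonneg hK.le,
      inv_mul_le_iff₀ hK, mul_comm] at h2
    exact h2
  refine ⟨C, hC0, fun x K hK hx => ?_⟩
  -- The constant `K = 0` cannot be normalized to 1, so `K + η/C` is used and `η` is let go to 0.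
  refine le_of_forall_pos_le_add fun η hη => ?_
  have := hpos x (K + η / C) (by positivity) (hx.mono (by linarith [show 0 < η / C by positivity]))
  rwa [mul_add, mul_div_cancel₀ _ hC0.ne'] at this

end Space

/-! ### Membership in the mean Lipschitz space -/

/-- The circle integral of `|1-z|^(-s(1-ε))` is `O((1-r)^(1-s(1-ε)))` because the exponent exceeds
1. With the factor `(1-r)^(-εs)` this is `(1-r)^(1-s)`: the parameter `ε` drops out. -/
theorem SingularBound.mem_meanLipschitz {s ε K : ℝ} (hs : 1 < s)
    (hsε : 1 < s * (1 - ε)) {g : HolDisc} (hg : SingularBound ε K g) :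
    g ∈ meanLipschitz s (1 / s) := by
  have hπ := Real.pi_pos
  have hK : 0 ≤ K := (norm_nonneg _).trans hg.1
  have hs0 : 0 < s := by linarith
  obtain ⟨C, hC0, hC⟩ := exists_integral_norm_one_sub_rpow_le hsε
  refine ⟨K * (1 / (2 * Real.pi) * C) ^ (1 / s), fun r hr0 hr1 => ?_⟩
  have hδ : 0 < 1 - r := by linarith
  have hn : ∀ θ : ℝ, ‖(r : ℂ) * Complex.exp (θ * Complex.I)‖ = r := fun θ => by
    rw [norm_mul, Complex.norm_exp_ofReal_mul_I, Complex.norm_real, mul_one,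
      Real.norm_of_nonneg hr0.le]
  have hcg : Continuous fun θ : ℝ =>
      ‖deriv (g : ℂ → ℂ) (r * Complex.exp (θ * Complex.I))‖ ^ s := by
    refine Continuous.rpow_const (Continuous.norm ?_) fun _ => Or.inr hs0.le
    refine (g.2.1.deriv Metric.isOpen_ball).continuousOn.comp_continuous (by fun_prop) fun θ => ?_
    rw [mem_ball_zero_iff, hn]
    exact hr1
  have hcw := continuous_norm_one_sub_rpow hr0.le hr1 (-(s * (1 - ε)))
  have h1 : ∫ θ in (0 : ℝ)..(2 * Real.pi),
      ‖deriv (g : ℂ → ℂ) (r * Complex.exp (θ * Complex.I))‖ ^ s ≤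
      K ^ s * (1 - r) ^ (-(ε * s)) * (C * (1 - r) ^ (1 - s * (1 - ε))) := by
    calc _ ≤ ∫ θ in (0 : ℝ)..(2 * Real.pi), K ^ s * (1 - r) ^ (-(ε * s)) *
          ‖1 - r * Complex.exp (θ * Complex.I)‖ ^ (-(s * (1 - ε))) := by
          refine intervalIntegral.integral_mono_on (by positivity)
            hcg.continuousOn.intervalIntegrable
            (hcw.const_mul _).continuousOn.intervalIntegrable fun θ _ => ?_
          have h2 := hg.2 (r * Complex.exp (θ * Complex.I)) (by rw [hn]; exact hr1)
          rw [hn] at h2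
          refine (Real.rpow_le_rpow (norm_nonneg _) h2 hs0.le).trans_eq ?_
          rw [Real.mul_rpow hK (by positivity), Real.mul_rpow (by positivity) (by positivity),
            ← Real.rpow_mul (norm_nonneg _), ← Real.rpow_mul hδ.le,
            show -(1 - ε) * s = -(s * (1 - ε)) by ring, neg_mul]
          ring
      _ ≤ _ := by
          rw [intervalIntegral.integral_const_mul]
          gcongr
          have hper : Function.Periodic (fun θ : ℝ =>
              ‖1 - r * Complex.exp (θ * Complex.I)‖ ^ (-(s * (1 - ε)))) (2 * Real.pi) := by
            intro θ
            simp only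
            rw [Complex.ofReal_add, add_mul, Complex.exp_add]
            simp
          have h3 := hper.intervalIntegral_add_eq 0 (-Real.pi)
          rw [zero_add, show -Real.pi + 2 * Real.pi = Real.pi by ring] at h3
          rw [h3]
          exact hC r hr0.le hr1
  have h2 : integralMean s r (deriv (g : ℂ → ℂ)) ≤
      K * (1 / (2 * Real.pi) * C) ^ (1 / s) * (1 - r) ^ (1 / s - 1) := by
    unfold integralMean
    have h0 : 0 ≤ ∫ θ in (0 : ℝ)..(2 * Real.pi),
        ‖deriv (g : ℂ → ℂ) (r * Complex.exp (θ * Complex.I))‖ ^ s :=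
      intervalIntegral.integral_nonneg (by positivity) fun _ _ => by positivity
    calc _ ≤ (1 / (2 * Real.pi) *
          (K ^ s * (1 - r) ^ (-(ε * s)) * (C * (1 - r) ^ (1 - s * (1 - ε))))) ^ (1 / s) := by
          gcongr
      _ = (K ^ s * (1 / (2 * Real.pi) * C) * (1 - r) ^ (1 - s)) ^ (1 / s) := by
          congr 1
          rw [show 1 - s = -(ε * s) + (1 - s * (1 - ε)) by ring, Real.rpow_add hδ]
          ring
      _ = _ := by
          rw [Real.mul_rpow (by positivity) (by positivity), Real.mul_rpow (by positivity)
            (by positivity), ← Real.rpow_mul hK, ← Real.rpow_mul hδ.le,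
            mul_one_div_cancel hs0.ne', Real.rpow_one]
          congr 2
          field_simp
  calc _ ≤ (1 - r) ^ (1 - 1 / s) *
        (K * (1 / (2 * Real.pi) * C) ^ (1 / s) * (1 - r) ^ (1 / s - 1)) := by gcongr
    _ = K * (1 / (2 * Real.pi) * C) ^ (1 / s) *
        ((1 - r) ^ (1 - 1 / s) * (1 - r) ^ (1 / s - 1)) := by ring
    _ = _ := by
        rw [← Real.rpow_add hδ]
        simp

/-! ### Tails of vanishing Carleson measures -/

/-- Beyond the cut the quotient of `μ` is already small. Before it, the restricted measure has no
more mass than at the cut, while the logarithm is smaller and `1 - t` larger. -/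
theorem IsVanishingLogCarleson.exists_logCarlesonBound_restrict {β : ℝ} (hβ : 0 ≤ β)
    {μ : Measure (Set.Ico (0 : ℝ) 1)} [IsFiniteMeasure μ] (h : IsVanishingLogCarleson β 1 μ)
    {η : ℝ} (hη : 0 < η) :
    ∃ ρ : ℝ, 0 ≤ ρ ∧ ρ < 1 ∧ LogCarlesonBound β η (μ.restrict {x | ρ ≤ (x : ℝ)}) := by
  have h1 := h.eventually_lt_const hη
  obtain ⟨ρ, hρ1, hρ⟩ := (mem_nhdsLT_iff_exists_Ioo_subset' (show (0 : ℝ) < 1 by norm_num)).1 h1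
  set a := (max ρ 0 + 1) / 2 with ha
  have hm : max ρ 0 < 1 := max_lt hρ1 (by norm_num)
  have ha0 : 0 ≤ a := by
    have := le_max_right ρ 0
    linarith
  have hρa : ρ < a := by
    have := le_max_left ρ 0
    linarith
  have ha1 : a < 1 := by linarith
  have key : ∀ t : ℝ, a ≤ t → t < 1 →
      (μ {x | t ≤ (x : ℝ)}).toReal * logWeight t ^ β ≤ η * (1 - t) := by
    intro t hat ht1
    have h2 : (μ {x | t ≤ (x : ℝ)}).toReal * Real.log (Real.exp 1 / (1 - t)) ^ β /
        (1 - t) ^ (1 : ℝ) < η := hρ ⟨hρa.trans_le hat, ht1⟩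
    rw [log_exp_one_div ht1, Real.rpow_one, div_lt_iff₀ (by linarith)] at h2
    exact h2.le
  refine ⟨a, ha0, ha1, fun t ht0 ht1 => ?_⟩
  have hL0 := one_le_logWeight ht0 ht1
  rcases le_total a t with hat | hta
  · refine le_trans ?_ (key t hat ht1)
    gcongr
    · exact measure_ne_top _ _
    · exact Measure.restrict_le_self
  · have h3 : (μ.restrict {x : Set.Ico (0 : ℝ) 1 | a ≤ (x : ℝ)} {x | t ≤ (x : ℝ)}).toReal ≤
        (μ {x | a ≤ (x : ℝ)}).toReal := by
      refine ENNReal.toReal_mono (measure_ne_top _ _) ?_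
      rw [Measure.restrict_apply (measurableSet_le measurable_const measurable_subtype_coe)]
      exact measure_mono Set.inter_subset_right
    have h4 := logWeight_le_logWeight hta ha1
    calc _ ≤ (μ {x | a ≤ (x : ℝ)}).toReal * logWeight a ^ β := by gcongr
      _ ≤ η * (1 - a) := key a le_rfl ha1
      _ ≤ _ := by gcongr

theorem LogCarlesonBound.exists_of_restrict {β η ρ : ℝ} (hβ : 0 ≤ β) (hη : 0 ≤ η)
    {μ : Measure (Set.Ico (0 : ℝ) 1)} [IsFiniteMeasure μ] (h0 : 0 ≤ ρ) (h1 : ρ < 1)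
    (h : LogCarlesonBound β η (μ.restrict {x | ρ ≤ (x : ℝ)})) :
    ∃ M : ℝ, 0 ≤ M ∧ LogCarlesonBound β M μ := by
  have hLρ := one_le_logWeight h0 h1
  have hρ : 0 < 1 - ρ := by linarith
  set B := (μ Set.univ).toReal * logWeight ρ ^ β / (1 - ρ) with hB
  have hB0 : 0 ≤ B := by positivity
  refine ⟨η + B, by positivity, fun t ht0 ht1 => ?_⟩
  have hL0 := one_le_logWeight ht0 ht1
  rcases le_total ρ t with hat | hta
  · have h2 := h t ht0 ht1
    have h3 : {x : Set.Ico (0 : ℝ) 1 | t ≤ (x : ℝ)} ∩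
        {x : Set.Ico (0 : ℝ) 1 | ρ ≤ (x : ℝ)} = {x : Set.Ico (0 : ℝ) 1 | t ≤ (x : ℝ)} :=
      Set.inter_eq_left.2 fun x hx => hat.trans hx
    rw [Measure.restrict_apply (measurableSet_le measurable_const measurable_subtype_coe),
      h3] at h2
    exact h2.trans (mul_le_mul_of_nonneg_right (by linarith) (by linarith))
  · have h4 := logWeight_le_logWeight hta h1
    calc _ ≤ (μ Set.univ).toReal * logWeight ρ ^ β := by
          gcongr
          · exact measure_ne_top _ _
          · exact Set.subset_univ _
      _ = B * (1 - ρ) := by rw [hB]; field_simp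
      _ ≤ (η + B) * (1 - t) := by gcongr; linarith

/-! ### Linearity, Taylor coefficients and monomials -/

section Linearity

variable (μ : Measure (Set.Ico (0 : ℝ) 1)) [IsFiniteMeasure μ]

theorem integrable_cesaro_integrand (f : HolDisc) {z : ℂ} (hz : ‖z‖ < 1) :
    Integrable (fun t : Set.Ico (0 : ℝ) 1 =>
      (f : ℂ → ℂ) ((t : ℝ) * z) / (1 - (t : ℝ) * z)) μ :=
  integrable_comp_Ico_mul μ (differentiableOn_div_one_sub f.2.1).continuousOn hz

theorem cesaroHol_add (f g : HolDisc) : cesaroHol μ (f + g) = cesaroHol μ f + cesaroHol μ g := by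
  refine HolDisc.ext_of_ball fun z hz => ?_
  rw [Submodule.coe_add, Pi.add_apply]
  simp only [coe_cesaroHol, cesaroLike_eq_integral μ _ hz]
  rw [← integral_add (integrable_cesaro_integrand μ f hz) (integrable_cesaro_integrand μ g hz)]
  refine integral_congr_ae (ae_of_all _ fun t => ?_)
  simp only [Submodule.coe_add, Pi.add_apply, add_div]

theorem cesaroHol_smul (c : ℂ) (f : HolDisc) : cesaroHol μ (c • f) = c • cesaroHol μ f := by
  refine HolDisc.ext_of_ball fun z hz => ?_
  rw [Submodule.coe_smul, Pi.smul_apply]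
  simp only [coe_cesaroHol, cesaroLike_eq_integral μ _ hz]
  rw [← integral_smul]
  refine integral_congr_ae (ae_of_all _ fun t => ?_)
  simp only [Submodule.coe_smul, Pi.smul_apply, smul_eq_mul, mul_div_assoc]

theorem cesaroHol_restrict_add_compl {S : Set (Set.Ico (0 : ℝ) 1)} (hS : MeasurableSet S)
    (f : HolDisc) :
    cesaroHol (μ.restrict S) f + cesaroHol (μ.restrict Sᶜ) f = cesaroHol μ f := by
  refine HolDisc.ext_of_ball fun z hz => ?_
  rw [Submodule.coe_add, Pi.add_apply]
  simp only [coe_cesaroHol, cesaroLike_eq_integral _ _ hz]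
  exact integral_add_compl hS (integrable_cesaro_integrand μ f hz)

end Linearity

theorem taylorCoeff0_add (f g : HolDisc) (n : ℕ) :
    taylorCoeff0 (f + g : HolDisc) n = taylorCoeff0 f n + taylorCoeff0 g n := by
  have h : ∀ f : HolDisc, ContDiffAt ℂ n (f : ℂ → ℂ) 0 := fun f =>
    (f.2.1.analyticAt (Metric.isOpen_ball.mem_nhds (by simp))).contDiffAt
  rw [taylorCoeff0, Submodule.coe_add, iteratedDeriv_add (h f) (h g), add_div]
  rfl

theorem taylorCoeff0_smul (c : ℂ) (f : HolDisc) (n : ℕ) :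
    taylorCoeff0 (c • f : HolDisc) n = c * taylorCoeff0 f n := by
  have h : ContDiffAt ℂ n (f : ℂ → ℂ) 0 :=
    (f.2.1.analyticAt (Metric.isOpen_ball.mem_nhds (by simp))).contDiffAt
  rw [taylorCoeff0, Submodule.coe_smul, iteratedDeriv_const_smul h c, smul_eq_mul, mul_div_assoc]
  rfl

/-- Cauchy's estimates give `|a_k| ≤ B R^(-k) ≤ B R^(-n)` for each of the `n + 1` terms. -/
theorem norm_taylorPartialSum_le {f : HolDisc} {R B : ℝ} (hR0 : 0 < R) (hR1 : R < 1)
    (hB : ∀ z : ℂ, ‖z‖ = R → ‖(f : ℂ → ℂ) z‖ ≤ B) (n : ℕ) :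
    ‖taylorPartialSum f n‖ ≤ (n + 1) * (B * (R⁻¹) ^ n) := by
  have hB0 : 0 ≤ B := (norm_nonneg _).trans (hB R (by
    rw [Complex.norm_real, Real.norm_of_nonneg hR0.le]))
  have h1 : 1 ≤ R⁻¹ := (one_le_inv₀ hR0).2 hR1.le
  refine (norm_sum_le_of_le _ fun k hk => ?_ : _ ≤
    ∑ _k ∈ Finset.range (n + 1), B * (R⁻¹) ^ n).trans_eq (by simp)
  have h2 := Complex.norm_iteratedDeriv_le_of_forall_mem_sphere_norm_le (f := (f : ℂ → ℂ))
    (c := 0) (C := B) k hR0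
    (f.2.1.diffContOnCl_ball (Metric.closedBall_subset_ball hR1))
    fun z hz => hB z (by simpa using hz)
  have hk' : (0 : ℝ) < k.factorial := by exact_mod_cast k.factorial_pos
  rw [taylorCoeff0, norm_div, Complex.norm_natCast, div_le_iff₀ hk']
  refine h2.trans ?_
  calc (k.factorial : ℝ) * B / R ^ k = B * (R⁻¹) ^ k * k.factorial := by
        rw [inv_pow]
        ring
    _ ≤ _ := by
        gcongr
        exact Nat.lt_succ_iff.1 (Finset.mem_range.1 hk)

/-- The monomial `z ↦ zⁿ` on the disc. -/
noncomputable def monomialHol (n : ℕ) : HolDisc :=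
  ⟨(Metric.ball (0 : ℂ) 1).indicator fun z => z ^ n,
    (differentiable_id.pow n).differentiableOn.congr fun _ hz => Set.indicator_of_mem hz _,
    fun _ hz => Set.indicator_of_notMem hz _⟩

theorem monomialHol_apply (n : ℕ) {z : ℂ} (hz : ‖z‖ < 1) :
    (monomialHol n : ℂ → ℂ) z = z ^ n :=
  Set.indicator_of_mem (by simpa using hz) _

/-- The weight is at least `1/2` on the disc, which gives `2n`; the extra 1 covers the value at the
origin for `n = 0`. Only polynomial growth in `n` matters later. -/
theorem singularBound_monomialHol {ε : ℝ} (hε0 : 0 ≤ ε) (hε1 : ε ≤ 1) (n : ℕ) :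
    SingularBound ε (2 * n + 1) (monomialHol n) := by
  refine ⟨?_, fun z hz => ?_⟩
  · rw [monomialHol_apply n (by simp), norm_pow, norm_zero]
    refine (pow_le_one₀ le_rfl zero_le_one).trans ?_
    linarith [show (0 : ℝ) ≤ n from n.cast_nonneg]
  · have hz1 : 0 < 1 - ‖z‖ := by linarith
    have h0 := one_sub_norm_le_norm_one_sub z
    have e : deriv (monomialHol n : ℂ → ℂ) z = n * z ^ (n - 1) := by
      have h1 : (monomialHol n : ℂ → ℂ) =ᶠ[𝓝 z] fun w => w ^ n := by
        filter_upwards [Metric.isOpen_ball.mem_nhds (show z ∈ Metric.ball 0 1 by simpa using hz)]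
          with w hw
        exact monomialHol_apply n (by simpa using hw)
      rw [h1.deriv_eq]
      simp
    have h2 : ‖1 - z‖ ≤ 2 := (norm_sub_le _ _).trans (by rw [norm_one]; linarith)
    have h3 : (1 / 2 : ℝ) ≤ ‖1 - z‖ ^ (-(1 - ε)) := by
      calc (1 / 2 : ℝ) = 2 ^ (-1 : ℝ) := by rw [Real.rpow_neg_one]; norm_num
        _ ≤ 2 ^ (-(1 - ε)) := Real.rpow_le_rpow_of_exponent_le (by norm_num) (by linarith)
        _ ≤ _ := Real.rpow_le_rpow_of_nonpos (by linarith) h2 (by linarith)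
    have h4 : 1 ≤ (1 - ‖z‖) ^ (-ε) :=
      Real.one_le_rpow_of_pos_of_le_one_of_nonpos hz1 (by linarith [norm_nonneg z]) (by linarith)
    rw [e, norm_mul, Complex.norm_natCast, norm_pow]
    have h5 : ‖z‖ ^ (n - 1) ≤ 1 := pow_le_one₀ (norm_nonneg z) hz.le
    calc (n : ℝ) * ‖z‖ ^ (n - 1) ≤ n := mul_le_of_le_one_right n.cast_nonneg h5
      _ ≤ (2 * n + 1) * (1 / 2 * 1) := by linarith
      _ ≤ _ := by gcongr

theorem hasSum_tsum_clm_apply {E X : Type*} [NormedAddCommGroup E] [NormedSpace ℂ E]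
    [NormedAddCommGroup X] [NormedSpace ℂ X]
    {S : ℕ → E →L[ℂ] X} (hs : Summable S) (f : E) :
    HasSum (fun n => S n f) ((∑' n, S n : E →L[ℂ] X) f) :=
  (ContinuousLinearMap.apply ℂ X f).hasSum hs.hasSum

theorem isCompactOperator_smulRight {E X : Type*} [NormedAddCommGroup E] [NormedSpace ℂ E]
    [NormedAddCommGroup X] [NormedSpace ℂ X]
    (A : E →L[ℂ] ℂ) (x : X) : IsCompactOperator (A.smulRight x) :=
  ((isCompactOperator_of_locallyCompactSpace_dom A).clm_comp
    (ContinuousLinearMap.toSpanSingleton ℂ x) :)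

/-! ### Boundedness and compactness of the operator into `X` -/

section Operator

variable {X : Type*} [NormedAddCommGroup X] [NormedSpace ℂ X] [CompleteSpace X]
  {ι : X →ₗ[ℂ] HolDisc}

/-- Under a logarithmic Carleson condition, the Cesàro-like operator is bounded from `B_p`, with
norm controlled by the Carleson constant. -/
theorem exists_bounded_cesaro {p q : ℝ} [Fact (1 < p)] (hpq : p.HolderConjugate q)
    (hX : IsSpaceOfAnalyticFunctions ι) {ε : ℝ} (hε0 : 0 < ε) (hε1 : ε ≤ 1)
    (hr : ∀ (g : HolDisc) (K : ℝ), SingularBound ε K g → g ∈ Set.range ι) :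
    ∃ C : ℝ, 0 < C ∧ ∀ (ν : Measure (Set.Ico (0 : ℝ) 1)) [IsFiniteMeasure ν] (M : ℝ), 0 ≤ M →
      LogCarlesonBound (1 / q) M ν →
      ∃ T : Besov p →L[ℂ] X, (∀ f, ι (T f) = cesaroHol ν (Besov.toHol f)) ∧ ‖T‖ ≤ C * M := by
  have hβ : 0 ≤ 1 / q := by
    have := hpq.symm.pos
    positivity
  obtain ⟨C₁, hC₁, h₁⟩ := Besov.exists_norm_apply_le hpq
  obtain ⟨C₂, hC₂, h₂⟩ := exists_norm_deriv_cesaroLike_le hβ hε0 hε1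
  obtain ⟨C₃, hC₃, h₃⟩ := hX.exists_norm_le hε1 hr
  refine ⟨C₃ * (C₂ * C₁ + 1), by positivity, fun ν _ M hM hν => ?_⟩
  have hb : ∀ f : Besov p, SingularBound ε ((C₂ * C₁ + 1) * M * ‖f‖)
      (cesaroHol ν (Besov.toHol f)) := by
    intro f
    refine ⟨?_, fun z hz => ?_⟩
    · rw [coe_cesaroHol, cesaroLike_eq_integral ν _ (by simp)]
      simp only [mul_zero, sub_zero, div_one, integral_const, norm_smul]
      -- At `t = 0` the Carleson bound says that the total mass is at most `M`, which controls
      -- `C_ν(f)(0) = ν_0 f(0)`.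
      have h4 := hν 0 le_rfl one_pos
      have h5 : {x : Set.Ico (0 : ℝ) 1 | (0 : ℝ) ≤ (x : ℝ)} = Set.univ :=
        Set.eq_univ_of_forall fun x => x.2.1
      rw [h5] at h4
      simp only [logWeight, sub_zero, Real.log_one, Real.one_rpow, mul_one] at h4
      have h6 : ‖(Besov.toHol f : ℂ → ℂ) 0‖ ≤ ‖f‖ := by
        rw [Besov.norm_def]
        linarith [(ENNReal.toReal_nonneg : 0 ≤ (besovSeminorm p (Besov.toHol f)).toReal)]
      rw [Real.norm_of_nonneg measureReal_nonneg]
      calc _ ≤ M * ‖f‖ := mul_le_mul h4 h6 (norm_nonneg _) hM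
        _ ≤ _ := by
          have : 0 ≤ C₂ * C₁ * (M * ‖f‖) := by positivity
          linarith
    · refine (h₂ ν M (C₁ * ‖f‖) (Besov.toHol f) hν hM (by positivity) (h₁ f) z hz).trans ?_
      have hz1 : 0 < 1 - ‖z‖ := by linarith
      refine mul_le_mul_of_nonneg_right ?_ (by positivity)
      have : 0 ≤ M * ‖f‖ := by positivity
      linarith
  choose Λ hΛ using fun f : Besov p => hr _ _ (hb f)
  let L : Besov p →ₗ[ℂ] X :=
    { toFun := Λ
      map_add' := fun f g => hX.injective (by
        rw [map_add, hΛ, hΛ, hΛ, map_add, cesaroHol_add])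
      map_smul' := fun c f => hX.injective (by
        rw [RingHom.id_apply, map_smul, hΛ, hΛ, map_smul, cesaroHol_smul]) }
  have hL : ∀ f, ‖L f‖ ≤ C₃ * (C₂ * C₁ + 1) * M * ‖f‖ := fun f => by
    have := h₃ (Λ f) ((C₂ * C₁ + 1) * M * ‖f‖) (by positivity) (by rw [hΛ]; exact hb f)
    calc ‖L f‖ ≤ _ := this
      _ = _ := by ring
  exact ⟨L.mkContinuous _ hL, hΛ, L.mkContinuous_norm_le (by positivity) hL⟩

theorem moment01_restrict_le (μ : Measure (Set.Ico (0 : ℝ) 1)) [IsFiniteMeasure μ] {ρ : ℝ}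
    (hρ : 0 ≤ ρ) (n : ℕ) :
    |moment01 (μ.restrict {x | ρ ≤ (x : ℝ)}ᶜ) n| ≤ ρ ^ n * μ.real Set.univ := by
  have h1 := norm_setIntegral_le_of_norm_le_const (μ := μ) (C := ρ ^ n)
    (f := fun t : Set.Ico (0 : ℝ) 1 => (t : ℝ) ^ n) (measure_lt_top μ {x | ρ ≤ (x : ℝ)}ᶜ)
    fun t ht => by
      rw [norm_pow, Real.norm_of_nonneg t.2.1]
      exact pow_le_pow_left₀ t.2.1 (not_le.1 (show ¬ρ ≤ (t : ℝ) from ht)).le n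
  refine h1.trans ?_
  exact mul_le_mul_of_nonneg_left (measureReal_mono (Set.subset_univ _)) (by positivity)

theorem isCompactOperator_tsum {E : Type*} [NormedAddCommGroup E] [NormedSpace ℂ E]
    {S : ℕ → E →L[ℂ] X} (hs : Summable S) (hS : ∀ n, IsCompactOperator (S n)) :
    IsCompactOperator (∑' n, S n : E →L[ℂ] X) := by
  have hcl := isClosed_setOfPred_isCompactOperator (σ₁₂ := RingHom.id ℂ) (M₁ := E) (M₂ := X)
  refine hcl.mem_of_tendsto hs.hasSum (Eventually.of_forall fun s => ?_)
  induction s using Finset.cons_induction with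
  | empty => exact isCompactOperator_zero
  | cons a s ha ih =>
    rw [Finset.sum_cons]
    exact (hS a).add ih

/-- For a measure supported in `[0, ρ)`, `ρ < 1`, the Cesàro-like operator is compact. -/
theorem exists_compact_cesaro_of_lt_one {p q : ℝ} [Fact (1 < p)] (hpq : p.HolderConjugate q)
    (hX : IsSpaceOfAnalyticFunctions ι) {ε : ℝ} (hε0 : 0 < ε) (hε1 : ε ≤ 1)
    (hr : ∀ (g : HolDisc) (K : ℝ), SingularBound ε K g → g ∈ Set.range ι)
    (μ : Measure (Set.Ico (0 : ℝ) 1)) [IsFiniteMeasure μ] {ρ : ℝ} (hρ0 : 0 ≤ ρ) (hρ1 : ρ < 1) :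
    ∃ T : Besov p →L[ℂ] X,
      (∀ f, ι (T f) = cesaroHol (μ.restrict {x | ρ ≤ (x : ℝ)}ᶜ) (Besov.toHol f)) ∧
      IsCompactOperator T := by
  set ν := μ.restrict {x : Set.Ico (0 : ℝ) 1 | ρ ≤ (x : ℝ)}ᶜ with hν
  obtain ⟨C₁, hC₁, h₁⟩ := Besov.exists_norm_apply_le hpq
  obtain ⟨C₃, hC₃, h₃⟩ := hX.exists_norm_le hε1 hr
  -- The moments of the truncated measure decay like `ρ^n` and the partial sums grow at most like
  -- `(n+1) R^(-n)`; taking `R > ρ` makes the product geometrically small.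
  obtain ⟨R, hρR, hR1⟩ := exists_between hρ1
  have hR0 : 0 < R := hρ0.trans_lt hρR
  have hLR := one_le_logWeight hR0.le hR1
  set B := C₁ * logWeight R ^ (1 / q) with hB
  have hB0 : 0 ≤ B := by positivity
  choose x hx using fun n => hr _ _ (singularBound_monomialHol hε0.le hε1 n)
  have hxn : ∀ n, ‖x n‖ ≤ C₃ * (2 * n + 1) := fun n =>
    h₃ _ _ (by positivity) (by rw [hx]; exact singularBound_monomialHol hε0.le hε1 n)
  let A : ℕ → Besov p →ₗ[ℂ] ℂ := fun n =>
    { toFun := fun f => taylorPartialSum (Besov.toHol f) n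
      map_add' := fun f g => by
        simp only [taylorPartialSum, map_add, taylorCoeff0_add, Finset.sum_add_distrib]
      map_smul' := fun c f => by
        simp only [taylorPartialSum, map_smul, taylorCoeff0_smul, ← Finset.mul_sum,
          RingHom.id_apply, smul_eq_mul] }
  have hA : ∀ n f, ‖A n f‖ ≤ (n + 1) * (B * (R⁻¹) ^ n) * ‖f‖ := by
    intro n f
    refine (norm_taylorPartialSum_le (B := C₁ * ‖f‖ * logWeight R ^ (1 / q)) hR0 hR1
      (fun z hz => hz ▸ h₁ f z (hz ▸ hR1)) n).trans_eq ?_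
    rw [hB]
    ring
  let A' : ℕ → Besov p →L[ℂ] ℂ := fun n => (A n).mkContinuous _ (hA n)
  have hA' : ∀ n, ‖A' n‖ ≤ (n + 1) * (B * (R⁻¹) ^ n) := fun n =>
    (A n).mkContinuous_norm_le (by positivity) (hA n)
  -- The `n`-th summand of the series for `C_ν`, as the rank-one operator `f ↦ ν_n (∑_{k ≤ n} a_k)
  -- zⁿ`.
  let S : ℕ → Besov p →L[ℂ] X := fun n => ((moment01 ν n : ℝ) : ℂ) • (A' n).smulRight (x n)
  have hS : ∀ n, ‖S n‖ ≤ μ.real Set.univ * B * C₃ * ((n + 1) * (2 * n + 1) * (ρ * R⁻¹) ^ n) := by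
    intro n
    rw [norm_smul, Complex.norm_real, Real.norm_eq_abs, ContinuousLinearMap.norm_smulRight_apply]
    calc _ ≤ (ρ ^ n * μ.real Set.univ) * (((n + 1) * (B * (R⁻¹) ^ n)) * (C₃ * (2 * n + 1))) := by
          gcongr
          · exact moment01_restrict_le μ hρ0 n
          · exact hA' n
          · exact hxn n
      _ = _ := by
          rw [mul_pow]
          ring
  have hq1 : ‖ρ * R⁻¹‖ < 1 := by
    rw [Real.norm_of_nonneg (by positivity), ← div_eq_mul_inv, div_lt_one hR0]
    exact hρR
  have hsum : Summable S := by
    refine Summable.of_norm_bounded (Summable.mul_left _ ?_) hS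
    have h2 := summable_pow_mul_geometric_of_norm_lt_one 2 hq1
    have h3 := summable_pow_mul_geometric_of_norm_lt_one 1 hq1
    have h4 := summable_pow_mul_geometric_of_norm_lt_one 0 hq1
    refine (((h2.mul_left 2).add (h3.mul_left 3)).add h4).congr fun n => ?_
    ring
  refine ⟨∑' n, S n, fun f => HolDisc.ext_of_ball fun z hz => ?_, ?_⟩
  · have h2 : HasSum (fun n => S n f) ((∑' n, S n) f) :=
      hasSum_tsum_clm_apply hsum f
    let E : X →L[ℂ] ℂ := ⟨⟨⟨fun x => (ι x : ℂ → ℂ) z, fun a b => by simp⟩, fun c a => by simp⟩,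
      hX.continuous_eval z (by simpa using hz)⟩
    have h3 : HasSum (fun n => E (S n f)) ((ι ((∑' n, S n) f) : ℂ → ℂ) z) := E.hasSum h2
    refine h3.unique ?_
    rw [coe_cesaroHol, cesaroLike_eq_integral ν _ hz]
    refine (hasSum_cesaroLike ν (Besov.toHol f).2.1 hz).congr_fun fun n => ?_
    change (ι (((moment01 ν n : ℝ) : ℂ) • (taylorPartialSum (Besov.toHol f) n • x n)) : ℂ → ℂ) z = _
    rw [map_smul, map_smul, hx]
    change _ * (_ * (monomialHol n : ℂ → ℂ) z) = _
    rw [monomialHol_apply n hz, mul_assoc]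
  · exact isCompactOperator_tsum hsum fun n =>
      (isCompactOperator_smulRight (A' n) (x n)).smul ((moment01 ν n : ℝ) : ℂ)

/-- Compact operators are norm-closed, and subtracting the compact operator of the part on `[0, ρ)`
leaves the operator of the tail, whose norm is at most a constant times its small Carleson constant.
-/
theorem exists_compact_cesaro {p q : ℝ} [Fact (1 < p)] (hpq : p.HolderConjugate q)
    (hX : IsSpaceOfAnalyticFunctions ι) {ε : ℝ} (hε0 : 0 < ε) (hε1 : ε ≤ 1)
    (hr : ∀ (g : HolDisc) (K : ℝ), SingularBound ε K g → g ∈ Set.range ι)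
    (μ : Measure (Set.Ico (0 : ℝ) 1)) [IsFiniteMeasure μ]
    (hμ : IsVanishingLogCarleson (1 / q) 1 μ) :
    ∃ T : Besov p →L[ℂ] X, (∀ f, ι (T f) = cesaroHol μ (Besov.toHol f)) ∧
      IsCompactOperator T := by
  have hβ : 0 ≤ 1 / q := by
    have := hpq.symm.pos
    positivity
  obtain ⟨C, hC, h⟩ := exists_bounded_cesaro hpq hX hε0 hε1 hr
  obtain ⟨ρ₀, hρ₀, hρ₁, hb⟩ := hμ.exists_logCarlesonBound_restrict hβ one_pos
  obtain ⟨M, hM, hMμ⟩ := LogCarlesonBound.exists_of_restrict hβ zero_le_one hρ₀ hρ₁ hb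
  obtain ⟨T, hT, -⟩ := h μ M hM hMμ
  refine ⟨T, hT, ?_⟩
  have hcl := isClosed_setOfPred_isCompactOperator (σ₁₂ := RingHom.id ℂ) (M₁ := Besov p)
    (M₂ := X)
  refine hcl.closure_subset (Metric.mem_closure_iff.2 fun η hη => ?_)
  obtain ⟨ρ, hρ0, hρ1, hρ⟩ := hμ.exists_logCarlesonBound_restrict hβ
    (show 0 < η / (2 * C) by positivity)
  obtain ⟨U, hU, hUn⟩ := h _ _ (by positivity) hρ
  obtain ⟨S, hS, hSc⟩ := exists_compact_cesaro_of_lt_one hpq hX hε0 hε1 hr μ hρ0 hρ1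
  refine ⟨S, hSc, ?_⟩
  have e : T - S = U := by
    ext f
    refine hX.injective ?_
    rw [sub_apply, map_sub, hT, hS, hU, ← cesaroHol_restrict_add_compl μ
      (measurableSet_le measurable_const measurable_subtype_coe :
        MeasurableSet {x : Set.Ico (0 : ℝ) 1 | ρ ≤ (x : ℝ)}), add_sub_cancel_right]
  rw [dist_eq_norm, e]
  refine hUn.trans_lt ?_
  rw [show C * (η / (2 * C)) = η / 2 by field_simp]
  linarith

end Operator

/-! ### Logarithmic test functions in the Besov space -/

theorem lintegral_one_sub_rpow_le {p a : ℝ} (hp : 1 < p) (ha1 : a < 1) :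
    ∫⁻ ρ in Set.Ioo a 1, ENNReal.ofReal ((1 - ρ) ^ (p - 2)) =
      ENNReal.ofReal ((1 - a) ^ (p - 1) / (p - 1)) := by
  have hi : IntervalIntegrable (fun ρ : ℝ => (1 - ρ) ^ (p - 2)) volume a 1 := by
    have := (intervalIntegral.intervalIntegrable_rpow' (a := 1 - a) (b := 1 - 1)
      (show -1 < p - 2 by linarith)).comp_sub_left 1
    simpa using this
  rw [← ofReal_integral_eq_lintegral_ofReal, ← integral_Ioc_eq_integral_Ioo,
    ← intervalIntegral.integral_of_le ha1.le]
  · rw [intervalIntegral.integral_comp_sub_left (fun x => x ^ (p - 2)) 1,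
      integral_rpow (Or.inl (by linarith)), sub_self, show p - 2 + 1 = p - 1 by ring,
      Real.zero_rpow (by linarith), sub_zero]
  · exact (hi.1).mono_set Set.Ioo_subset_Ioc_self
  · filter_upwards [ae_restrict_mem measurableSet_Ioo] with x hx
    have : 0 < 1 - x := by linarith [hx.2]
    positivity

/-- Split at `ρ = a`. Below, `1 - aρ ≥ 1 - ρ` leaves `1/(1-ρ)`, whose integral is the logarithm;
above, `1 - aρ ≥ 1 - a` leaves a bounded contribution `1/(p-1)`. -/
theorem lintegral_radial_weight_le {p a : ℝ} (hp : 1 < p) (ha0 : 0 ≤ a) (ha1 : a < 1) :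
    ∫⁻ ρ in Set.Ioo (0 : ℝ) 1, ENNReal.ofReal ((1 - ρ) ^ (p - 2) * (1 - a * ρ) ^ (1 - p)) ≤
      ENNReal.ofReal ((1 + 1 / (p - 1)) * logWeight a) := by
  have hp1 : 0 < p - 1 := by linarith
  have hδ : 0 < 1 - a := by linarith
  have hL := one_le_logWeight ha0 ha1
  calc _ ≤ ∫⁻ ρ in Set.Ioc 0 a ∪ Set.Ioo a 1,
        ENNReal.ofReal ((1 - ρ) ^ (p - 2) * (1 - a * ρ) ^ (1 - p)) :=
        lintegral_mono_set fun x hx => by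
          rcases le_or_gt x a with h | h
          · exact Or.inl ⟨hx.1, h⟩
          · exact Or.inr ⟨h, hx.2⟩
    _ ≤ (∫⁻ ρ in Set.Ioc 0 a, ENNReal.ofReal ((1 - ρ) ^ (p - 2) * (1 - a * ρ) ^ (1 - p))) +
        ∫⁻ ρ in Set.Ioo a 1, ENNReal.ofReal ((1 - ρ) ^ (p - 2) * (1 - a * ρ) ^ (1 - p)) :=
        lintegral_union_le _ _ _
    _ ≤ (∫⁻ ρ in Set.Ioc 0 a, ENNReal.ofReal ((1 - ρ)⁻¹)) +
        ∫⁻ ρ in Set.Ioo a 1, ENNReal.ofReal ((1 - a) ^ (1 - p)) *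
          ENNReal.ofReal ((1 - ρ) ^ (p - 2)) := by
        refine add_le_add (setLIntegral_mono' measurableSet_Ioc fun ρ hρ => ?_)
          (setLIntegral_mono' measurableSet_Ioo fun ρ hρ => ?_)
        · have h1 : 0 < 1 - ρ := by linarith [hρ.2]
          refine ENNReal.ofReal_le_ofReal ?_
          calc _ ≤ (1 - ρ) ^ (p - 2) * (1 - ρ) ^ (1 - p) := by
                refine mul_le_mul_of_nonneg_left ?_ (by positivity)
                exact Real.rpow_le_rpow_of_nonpos h1 (by nlinarith [hρ.1]) (by linarith)
            _ = _ := by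
                rw [← Real.rpow_add h1, ← Real.rpow_neg_one]
                congr 1
                ring
        · have h1 : 0 < 1 - ρ := by linarith [hρ.2]
          rw [← ENNReal.ofReal_mul (by positivity), mul_comm]
          refine ENNReal.ofReal_le_ofReal (mul_le_mul_of_nonneg_right ?_ (by positivity))
          exact Real.rpow_le_rpow_of_nonpos hδ (by nlinarith [hρ.1, hρ.2]) (by linarith)
    _ ≤ _ := by
        rw [integral_inv_one_sub_eq ha1 ha0, lintegral_const_mul' _ _ ENNReal.ofReal_ne_top,
          lintegral_one_sub_rpow_le hp ha1, ← ENNReal.ofReal_mul (by positivity),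
          ← ENNReal.ofReal_add ?_ (by positivity)]
        · refine ENNReal.ofReal_le_ofReal ?_
          have h1 : (1 - a) ^ (1 - p) * ((1 - a) ^ (p - 1) / (p - 1)) = 1 / (p - 1) := by
            rw [← mul_div_assoc, ← Real.rpow_add hδ]
            simp
          have h2 : -Real.log (1 - a) ≤ logWeight a := by
            unfold logWeight
            linarith
          rw [h1, add_mul, one_mul]
          refine add_le_add h2 (le_mul_of_one_le_right (by positivity) hL)
        · unfold logWeight at hL
          linarith

/-- The function `z ↦ -log (1 - a z)` on the disc. -/
noncomputable def logHol (a : ℝ) : ℂ → ℂ :=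
  (Metric.ball (0 : ℂ) 1).indicator fun z => -Complex.log (1 - a * z)

theorem logHol_apply (a : ℝ) {z : ℂ} (hz : ‖z‖ < 1) : logHol a z = -Complex.log (1 - a * z) :=
  Set.indicator_of_mem (by simpa using hz) _

theorem norm_ofReal_mul_lt_one {a : ℝ} (ha0 : 0 ≤ a) (ha1 : a < 1) {z : ℂ} (hz : ‖z‖ < 1) :
    ‖(a : ℂ) * z‖ < 1 :=
  (norm_Ico_mul_le ⟨a, ha0, ha1⟩ z).trans_lt hz

theorem hasDerivAt_logHol {a : ℝ} (ha0 : 0 ≤ a) (ha1 : a < 1) {z : ℂ} (hz : ‖z‖ < 1) :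
    HasDerivAt (logHol a) (a / (1 - a * z)) z := by
  have h1 : (1 - a * z) ∈ Complex.slitPlane := by
    have := Complex.mem_slitPlane_of_norm_lt_one (z := -(a * z))
      (by rw [norm_neg]; exact norm_ofReal_mul_lt_one ha0 ha1 hz)
    rwa [← sub_eq_add_neg] at this
  have h2 : HasDerivAt (fun z : ℂ => 1 - a * z) (-a) z := by
    simpa using ((hasDerivAt_id z).const_mul (a : ℂ)).const_sub 1
  have h3 := (h2.clog h1).neg
  rw [neg_div, neg_neg] at h3
  refine h3.congr_of_eventuallyEq ?_
  filter_upwards [Metric.isOpen_ball.mem_nhds (show z ∈ Metric.ball 0 1 by simpa using hz)]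
    with w hw
  exact logHol_apply a (by simpa using hw)

theorem logHol_mem {a : ℝ} (ha0 : 0 ≤ a) (ha1 : a < 1) : logHol a ∈ HolDisc :=
  ⟨fun _ hz => (hasDerivAt_logHol ha0 ha1
      (by simpa using hz)).differentiableAt.differentiableWithinAt,
    fun _ hz => Set.indicator_of_notMem hz _⟩

theorem norm_logHol_le {a : ℝ} (ha0 : 0 ≤ a) (ha1 : a < 1) {z : ℂ} (hz : ‖z‖ < 1) :
    ‖logHol a z‖ ≤ (1 - ‖z‖)⁻¹ + 1 := by
  have hz1 : 0 < 1 - ‖z‖ := by linarith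
  have h1 := norm_Ico_mul_le ⟨a, ha0, ha1⟩ z
  simp only at h1
  have h2 := Complex.norm_log_one_add_le (z := -(a * z)) (by rw [norm_neg]; linarith)
  rw [norm_neg, ← sub_eq_add_neg] at h2
  rw [logHol_apply a hz, norm_neg]
  refine h2.trans (add_le_add ?_ (by linarith))
  have h3 : (1 - ‖(a : ℂ) * z‖)⁻¹ ≤ (1 - ‖z‖)⁻¹ := by gcongr
  have h4 : ‖(a : ℂ) * z‖ ^ 2 ≤ 1 := pow_le_one₀ (norm_nonneg _) (by linarith)
  have h5 : 0 < (1 - ‖(a : ℂ) * z‖)⁻¹ := inv_pos.2 (by linarith)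
  nlinarith

/-- The derivative is at most `1/|1 - az|`. In polar coordinates the circle integral with exponent
`p > 1` gives `(1-aρ)^(1-p)`, and the remaining radial integral grows only logarithmically. -/
theorem exists_besovSeminorm_logHol_le {p : ℝ} (hp : 1 < p) :
    ∃ C : ℝ, 0 < C ∧ ∀ a : ℝ, 0 ≤ a → a < 1 →
      besovSeminorm p (logHol a) ≤ ENNReal.ofReal (C * logWeight a ^ (1 / p)) := by
  obtain ⟨C, hC0, hC⟩ := exists_integral_norm_one_sub_rpow_le hp
  have hp1 : 0 < p - 1 := by linarith
  have hp0 : 0 < p := by linarith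
  set D := C * 3 ^ |p - 2| * (1 + 1 / (p - 1)) with hD
  have hD0 : 0 < D := by positivity
  refine ⟨D ^ (1 / p), by positivity, fun a ha0 ha1 => ?_⟩
  have hL := one_le_logWeight ha0 ha1
  have key : ∫⁻ w in Metric.ball (0 : ℂ) 1,
      ‖deriv (logHol a) w‖ₑ ^ p * ENNReal.ofReal ((1 - ‖w‖ ^ 2) ^ (p - 2)) ≤
        ENNReal.ofReal (D * logWeight a) := by
    rw [lintegral_ball_eq_polar (f := fun w => ‖deriv (logHol a) w‖ₑ ^ p *
      ENNReal.ofReal ((1 - ‖w‖ ^ 2) ^ (p - 2)))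
      (((measurable_deriv _).enorm.pow_const p).mul (measurable_besovWeight p))]
    calc _ ≤ ∫⁻ ρ in Set.Ioo (0 : ℝ) 1, ENNReal.ofReal (C * 3 ^ |p - 2|) *
          ENNReal.ofReal ((1 - ρ) ^ (p - 2) * (1 - a * ρ) ^ (1 - p)) := by
          refine setLIntegral_mono' measurableSet_Ioo fun ρ hρ => ?_
          have hρ1 : 0 < 1 - ρ := by linarith [hρ.2]
          have haρ0 : 0 ≤ a * ρ := mul_nonneg ha0 hρ.1.le
          have haρ1 : a * ρ < 1 := by nlinarith [hρ.1, hρ.2]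
          have hW : (1 - ρ ^ 2) ^ (p - 2) ≤ 3 ^ |p - 2| * (1 - ρ) ^ (p - 2) :=
            rpow_le_three_rpow_abs_mul (by nlinarith [hρ.1, hρ.2]) (by nlinarith [hρ.1, hρ.2])
              (by nlinarith [hρ.1, hρ.2]) _
          have hin : ∫⁻ θ in Set.Ioo (-Real.pi) Real.pi,
              ‖deriv (logHol a) (ρ * Complex.exp (θ * Complex.I))‖ₑ ^ p *
                ENNReal.ofReal ((1 - ‖(ρ : ℂ) * Complex.exp (θ * Complex.I)‖ ^ 2) ^ (p - 2)) ≤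
              ENNReal.ofReal (C * (1 - a * ρ) ^ (1 - p)) *
                ENNReal.ofReal ((1 - ρ ^ 2) ^ (p - 2)) := by
            have hn : ∀ θ : ℝ, ‖(ρ : ℂ) * Complex.exp (θ * Complex.I)‖ = ρ := fun θ => by
              rw [norm_mul, Complex.norm_exp_ofReal_mul_I, Complex.norm_real, mul_one,
                Real.norm_of_nonneg hρ.1.le]
            simp only [hn]
            rw [lintegral_mul_const' _ _ ENNReal.ofReal_ne_top]
            gcongr
            refine le_trans (lintegral_mono fun θ => ?_) ((ofReal_integral_eq_lintegral_ofReal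
              (f := fun θ : ℝ => ‖1 - ((a * ρ : ℝ) : ℂ) * Complex.exp (θ * Complex.I)‖ ^ (-p))
              ((continuous_norm_one_sub_rpow haρ0 haρ1 _).integrableOn_Icc.mono_set
                Set.Ioo_subset_Icc_self) (ae_of_all _ fun θ => by positivity)).symm.le.trans ?_)
            · rw [(hasDerivAt_logHol ha0 ha1 (by rw [hn]; exact hρ.2)).deriv, ← ofReal_norm,
                ENNReal.ofReal_rpow_of_nonneg (norm_nonneg _) hp0.le]
              refine ENNReal.ofReal_le_ofReal ?_
              rw [norm_div, Complex.norm_real, Real.norm_of_nonneg ha0, Real.rpow_neg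
                (norm_nonneg _), ← Real.inv_rpow (norm_nonneg _), Complex.ofReal_mul, mul_assoc]
              refine Real.rpow_le_rpow (by positivity) ?_ hp0.le
              rw [div_eq_mul_inv]
              exact mul_le_of_le_one_left (by positivity) ha1.le
            · refine ENNReal.ofReal_le_ofReal ?_
              rw [← integral_Ioc_eq_integral_Ioo,
                ← intervalIntegral.integral_of_le (by linarith [Real.pi_pos])]
              exact hC (a * ρ) haρ0 haρ1
          have hu : 0 < 1 - a * ρ := by linarith
          have hw : 0 ≤ 1 - ρ ^ 2 := by nlinarith [hρ.1, hρ.2]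
          calc _ ≤ 1 * (ENNReal.ofReal (C * (1 - a * ρ) ^ (1 - p)) *
                ENNReal.ofReal ((1 - ρ ^ 2) ^ (p - 2))) := by
                gcongr
                rw [← ENNReal.ofReal_one]
                exact ENNReal.ofReal_le_ofReal hρ.2.le
            _ ≤ _ := by
                rw [one_mul, ← ENNReal.ofReal_mul (by positivity),
                  ← ENNReal.ofReal_mul (by positivity)]
                refine ENNReal.ofReal_le_ofReal ?_
                calc _ ≤ C * (1 - a * ρ) ^ (1 - p) * (3 ^ |p - 2| * (1 - ρ) ^ (p - 2)) := by
                      gcongr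
                  _ = _ := by ring
      _ ≤ _ := by
          rw [lintegral_const_mul' _ _ ENNReal.ofReal_ne_top]
          calc _ ≤ ENNReal.ofReal (C * 3 ^ |p - 2|) *
                ENNReal.ofReal ((1 + 1 / (p - 1)) * logWeight a) := by
                gcongr
                exact lintegral_radial_weight_le hp ha0 ha1
            _ = _ := by
                rw [← ENNReal.ofReal_mul (by positivity), hD]
                congr 1
                ring
  rw [lintegral_besov_eq hp0] at key
  have h1 : besovSeminorm p (logHol a) ^ p ≤ ENNReal.ofReal (D * logWeight a) := by
    refine le_trans (le_mul_of_one_le_left zero_le ?_) key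
    rw [← ENNReal.ofReal_one]
    exact ENNReal.ofReal_le_ofReal (by linarith [Real.pi_gt_three])
  have h2 := ENNReal.rpow_le_rpow h1 (show 0 ≤ 1 / p by positivity)
  rwa [← ENNReal.rpow_mul, mul_one_div_cancel hp0.ne', ENNReal.rpow_one,
    ENNReal.ofReal_rpow_of_nonneg (by positivity) (by positivity),
    Real.mul_rpow hD0.le (by linarith)] at h2

theorem Besov.exists_toHol_eq {p : ℝ} [Fact (1 < p)] {f : HolDisc}
    (hf : besovSeminorm p f < ∞) : ∃ F : Besov p, toHol F = f :=
  ⟨(⟨f, hf⟩ : besovSubmodule p), rfl⟩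

/-- Normalized logarithms form a bounded family in `B_p`. -/
theorem Besov.exists_testFunctions (p : ℝ) [hp : Fact (1 < p)] :
    ∃ (F : ℝ → Besov p) (C : ℝ), ∀ a : ℝ, 0 ≤ a → a < 1 → ‖F a‖ ≤ C ∧
      (toHol (F a) : ℂ → ℂ) = fun z => ((logWeight a ^ (-(1 / p)) : ℝ) : ℂ) * logHol a z := by
  obtain ⟨C, hC0, hC⟩ := exists_besovSeminorm_logHol_le hp.out
  have h : ∀ a : ℝ, ∃ F : Besov p, 0 ≤ a → a < 1 → ‖F‖ ≤ C ∧
      (toHol F : ℂ → ℂ) = fun z => ((logWeight a ^ (-(1 / p)) : ℝ) : ℂ) * logHol a z := by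
    intro a
    by_cases ha : 0 ≤ a ∧ a < 1
    · obtain ⟨ha0, ha1⟩ := ha
      have hL : 0 < logWeight a := by linarith [one_le_logWeight ha0 ha1]
      set c := logWeight a ^ (-(1 / p)) with hc
      have hc0 : 0 < c := by positivity
      have h1 : besovSeminorm p ((c : ℂ) • (⟨logHol a, logHol_mem ha0 ha1⟩ : HolDisc) : HolDisc) ≤
          ENNReal.ofReal C := by
        rw [besovSeminorm_smul hp.out, ← ofReal_norm, Complex.norm_real,
          Real.norm_of_nonneg hc0.le]
        calc _ ≤ ENNReal.ofReal c * ENNReal.ofReal (C * logWeight a ^ (1 / p)) := by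
              gcongr
              exact hC a ha0 ha1
          _ = _ := by
              rw [← ENNReal.ofReal_mul hc0.le, hc, mul_left_comm, ← Real.rpow_add hL]
              simp
      obtain ⟨F, hF⟩ := exists_toHol_eq (h1.trans_lt ENNReal.ofReal_lt_top)
      refine ⟨F, fun _ _ => ⟨?_, by rw [hF]; rfl⟩⟩
      rw [norm_def, hF]
      have h2 : (((c : ℂ) • (⟨logHol a, logHol_mem ha0 ha1⟩ : HolDisc) : HolDisc) : ℂ → ℂ) 0
          = 0 := by
        change (c : ℂ) * logHol a 0 = 0
        rw [logHol_apply a (by simp)]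
        simp
      rw [h2, norm_zero, zero_add]
      exact ENNReal.toReal_le_of_le_ofReal hC0.le h1
    · exact ⟨0, fun h0 h1 => absurd ⟨h0, h1⟩ ha⟩
  choose F hF using h
  exact ⟨F, C, hF⟩

/-! ### Necessity of the vanishing condition -/

section Necessity

variable {X : Type*} [NormedAddCommGroup X] [NormedSpace ℂ X] {ι : X →ₗ[ℂ] HolDisc}

/-- A space of analytic functions contained in the Bloch space is continuously embedded. -/
theorem IsSpaceOfAnalyticFunctions.exists_bloch_bound [CompleteSpace X]
    (hX : IsSpaceOfAnalyticFunctions ι) (hB : Set.range ι ⊆ blochSpace) :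
    ∃ C : ℝ, ∀ (x : X) (z : ℂ), ‖z‖ < 1 →
      (1 - ‖z‖ ^ 2) * ‖deriv (ι x : ℂ → ℂ) z‖ ≤ C * ‖x‖ := by
  have hev : ∀ z : ℂ, Continuous fun x => (ι x : ℂ → ℂ) z := fun z => by
    by_cases hz : z ∈ Metric.ball (0 : ℂ) 1
    · exact hX.continuous_eval z hz
    · simp only [fun x => (ι x).2.2 z hz]
      exact continuous_const
  let E : ℂ → X →L[ℂ] ℂ := fun z =>
    ⟨⟨⟨fun x => (ι x : ℂ → ℂ) z, fun a b => by simp⟩, fun c a => by simp⟩, hev z⟩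
  have hD : ∀ z : Metric.ball (0 : ℂ) 1, ∃ D : X →L[ℂ] ℂ, ∀ x, D x = deriv (ι x : ℂ → ℂ) z := by
    intro z
    -- The derivative functional is a pointwise limit of continuous difference quotients, hence
    -- continuous by Banach–Steinhaus; evaluations off the disc vanish, so every increment is
    -- admissible.
    refine ⟨continuousLinearMapOfTendsto (l := 𝓝[≠] (0 : ℂ))
      (fun h => h⁻¹ • (E (z + h) - E z)) (f := fun x => deriv (ι x : ℂ → ℂ) z) ?_, fun x => rfl⟩
    refine tendsto_pi_nhds.2 fun x => ?_
    exact hasDerivAt_iff_tendsto_slope_zero.1 (HolDisc_differentiableAt (ι x) z.2).hasDerivAt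
  choose D hD using hD
  obtain ⟨C, hC⟩ := banach_steinhaus
    (g := fun z : Metric.ball (0 : ℂ) 1 => ((1 - ‖(z : ℂ)‖ ^ 2 : ℝ) : ℂ) • D z) fun x => by
      obtain ⟨B, hB⟩ := hB ⟨x, rfl⟩
      refine ⟨B, fun z => ?_⟩
      have hz : ‖(z : ℂ)‖ < 1 := mem_ball_zero_iff.1 z.2
      rw [smul_apply, hD, norm_smul, Complex.norm_real,
        Real.norm_of_nonneg (by nlinarith [norm_nonneg (z : ℂ)])]
      exact hB z z.2
  refine ⟨C, fun x z hz => ?_⟩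
  have h := (ContinuousLinearMap.le_opNorm _ x).trans
    (mul_le_mul_of_nonneg_right (hC ⟨z, by simpa using hz⟩) (norm_nonneg x))
  rw [smul_apply, hD, norm_smul, Complex.norm_real,
    Real.norm_of_nonneg (by nlinarith [norm_nonneg z])] at h
  exact h

theorem tendsto_logWeight : Tendsto logWeight (𝓝[<] 1) atTop := by
  have h1 : Tendsto (fun a : ℝ => 1 - a) (𝓝[<] 1) (𝓝[>] 0) := by
    refine tendsto_nhdsWithin_iff.2 ⟨?_, ?_⟩
    · have : Tendsto (fun a : ℝ => 1 - a) (𝓝 1) (𝓝 (1 - 1)) :=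
        (continuous_const.sub continuous_id).tendsto 1
      rw [sub_self] at this
      exact this.mono_left nhdsWithin_le_nhds
    · filter_upwards [self_mem_nhdsWithin] with a ha
      exact sub_pos.2 (show a < 1 from ha)
  exact tendsto_atTop_add_const_left _ 1
    (tendsto_neg_atBot_atTop.comp (Real.tendsto_log_nhdsGT_zero.comp h1))

/-- A compact operator acting as `C_μ` maps the test functions to a null family. -/
theorem tendsto_compact_testFunctions {p : ℝ} [hp : Fact (1 < p)]
    (hX : IsSpaceOfAnalyticFunctions ι) {μ : Measure (Set.Ico (0 : ℝ) 1)} [IsFiniteMeasure μ]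
    {T : Besov p →L[ℂ] X} (hT : ∀ f : Besov p, (ι (T f) : ℂ → ℂ) = cesaroLike μ (Besov.toHol f))
    (hTc : IsCompactOperator T) {F : ℝ → Besov p} {C : ℝ}
    (hF : ∀ a : ℝ, 0 ≤ a → a < 1 → ‖F a‖ ≤ C ∧ (Besov.toHol (F a) : ℂ → ℂ) =
      fun z => ((logWeight a ^ (-(1 / p)) : ℝ) : ℂ) * logHol a z) :
    Tendsto (fun a => T (F a)) (𝓝[<] 1) (𝓝 0) := by
  have hp0 : 0 < p := by linarith [hp.out]
  have hmem : ∀ᶠ a : ℝ in 𝓝[<] 1, 0 ≤ a ∧ a < 1 := by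
    filter_upwards [Ioo_mem_nhdsLT (show (0 : ℝ) < 1 by norm_num)] with a ha
      using ⟨ha.1.le, ha.2⟩
  obtain ⟨K, hK, hTK⟩ := hTc.image_closedBall_subset_compact C
  have hpt : ∀ z : ℂ, ‖z‖ < 1 →
      Tendsto (fun a => (ι (T (F a)) : ℂ → ℂ) z) (𝓝[<] 1) (𝓝 0) := by
    intro z hz
    have hz1 : 0 < 1 - ‖z‖ := by linarith
    -- At a fixed `z` the logarithms are bounded uniformly in `a` and `t`, so the normalizing factor
    -- alone forces decay.
    have h1 : Tendsto (fun a => logWeight a ^ (-(1 / p)) *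
        (((1 - ‖z‖)⁻¹ + 1) / (1 - ‖z‖) * μ.real Set.univ)) (𝓝[<] 1) (𝓝 0) := by
      have := ((tendsto_rpow_neg_atTop (show 0 < 1 / p by positivity)).comp
        tendsto_logWeight).mul_const (((1 - ‖z‖)⁻¹ + 1) / (1 - ‖z‖) * μ.real Set.univ)
      rwa [zero_mul] at this
    refine squeeze_zero_norm' ?_ h1
    filter_upwards [hmem] with a ⟨ha0, ha1⟩
    have hL := one_le_logWeight ha0 ha1
    rw [hT, cesaroLike_eq_integral μ _ hz, (hF a ha0 ha1).2]
    refine (norm_integral_le_of_norm_le_const (C := logWeight a ^ (-(1 / p)) *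
        (((1 - ‖z‖)⁻¹ + 1) / (1 - ‖z‖))) (ae_of_all _ fun t => ?_)).trans_eq (by ring)
    have ht := norm_Ico_mul_le t z
    have ht1 : ‖((t : ℝ) : ℂ) * z‖ < 1 := by linarith
    have h2 := one_sub_norm_le_norm_one_sub ((t : ℝ) * z)
    rw [norm_div, norm_mul, Complex.norm_real, Real.norm_of_nonneg (by positivity), mul_div_assoc]
    refine mul_le_mul_of_nonneg_left ?_ (by positivity)
    refine div_le_div₀ (by positivity) ((norm_logHol_le ha0 ha1 ht1).trans ?_) hz1 (by linarith)
    gcongr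
  -- The images stay in a compact set, and evaluation at each point shows that 0 is the only
  -- possible cluster point.
  refine hK.tendsto_nhds_of_unique_mapClusterPt ?_ fun y _ hy => ?_
  · filter_upwards [hmem] with a ⟨ha0, ha1⟩
    exact hTK ⟨F a, by simpa using (hF a ha0 ha1).1, rfl⟩
  · refine hX.ext fun z hz => ?_
    have h1 := hy.tendsto_comp (hX.tendsto_eval hz tendsto_id)
    have h2 : MapClusterPt ((ι y : ℂ → ℂ) z) (𝓝[<] (1 : ℝ)) fun a => (ι (T (F a)) : ℂ → ℂ) z := h1
    have h3 := eq_of_nhds_neBot (ClusterPt.mono h2 (hpt z hz))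
    rw [h3, map_zero]
    rfl

theorem deriv_logHol_div_one_sub {a x : ℝ} (ha0 : 0 ≤ a) (ha1 : a < 1) (hx0 : 0 ≤ x) (hx1 : x < 1)
    (c : ℝ) :
    deriv (fun w : ℂ => (c : ℂ) * logHol a w / (1 - w)) x =
      ((c * (a / (1 - a * x) * (1 - x) - Real.log (1 - a * x)) / (1 - x) ^ 2 : ℝ) : ℂ) := by
  have hx : ‖(x : ℂ)‖ < 1 := by rwa [Complex.norm_real, Real.norm_of_nonneg hx0]
  have hax : 0 ≤ 1 - a * x := by nlinarith
  have h1 : (1 - (x : ℂ)) ≠ 0 := by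
    rw [← Complex.ofReal_one, ← Complex.ofReal_sub, Complex.ofReal_ne_zero]
    linarith
  have h2 : HasDerivAt (fun w : ℂ => 1 - w) (-1) (x : ℂ) := by
    simpa using (hasDerivAt_id (x : ℂ)).const_sub 1
  rw [(((hasDerivAt_logHol ha0 ha1 hx).const_mul (c : ℂ)).fun_div h2 h1).deriv, logHol_apply a hx]
  push_cast [Complex.ofReal_log hax]
  ring

/-- At the real point `a` the integrand is real and nonnegative, so Markov's inequality applies. For
`t ≥ a` one has `ta ≥ a²`, and discarding the nonnegative term from the derivative of the logarithm
leaves the stated level. -/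
theorem measure_mul_le_norm_deriv_cesaroLike {a c : ℝ} (ha0 : 0 < a) (ha1 : a < 1) (hc : 0 ≤ c)
    (μ : Measure (Set.Ico (0 : ℝ) 1)) [IsFiniteMeasure μ] {f : HolDisc}
    (hf : (f : ℂ → ℂ) = fun z => (c : ℂ) * logHol a z) :
    a * (c * (-Real.log (1 - a ^ 3)) / (1 - a ^ 2) ^ 2) * (μ {x | a ≤ (x : ℝ)}).toReal ≤
      ‖deriv (cesaroLike μ f) a‖ := by
  have hna : ‖(a : ℂ)‖ < 1 := by rwa [Complex.norm_real, Real.norm_of_nonneg ha0.le]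
  set φ : Set.Ico (0 : ℝ) 1 → ℝ := fun t => t * (c * (a / (1 - a * (t * a)) * (1 - t * a) -
    Real.log (1 - a * (t * a))) / (1 - t * a) ^ 2) with hφ
  have hta : ∀ t : Set.Ico (0 : ℝ) 1, 0 ≤ (t : ℝ) * a ∧ (t : ℝ) * a < 1 := fun t =>
    ⟨mul_nonneg t.2.1 ha0.le, by nlinarith [t.2.1, t.2.2]⟩
  have hcoe : ∀ t : Set.Ico (0 : ℝ) 1, ((t : ℝ) : ℂ) *
      deriv (fun w => (f : ℂ → ℂ) w / (1 - w)) ((t : ℝ) * a) = (φ t : ℂ) := by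
    intro t
    rw [hf, ← Complex.ofReal_mul, deriv_logHol_div_one_sub ha0.le ha1 (hta t).1 (hta t).2,
      ← Complex.ofReal_mul]
  have hφ0 : ∀ t, 0 ≤ φ t := by
    intro t
    obtain ⟨h0, h1⟩ := hta t
    have h2 : 0 < 1 - a * (t * a) := by nlinarith
    have h3 : Real.log (1 - a * (t * a)) ≤ 0 := Real.log_nonpos h2.le (by nlinarith)
    have h4 : 0 < 1 - t * a := by linarith
    have h5 : 0 ≤ a / (1 - a * (t * a)) * (1 - t * a) := by positivity
    exact mul_nonneg t.2.1 (div_nonneg (mul_nonneg hc (by linarith)) (by positivity))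
  have hint : Integrable φ μ := by
    have h1 := integrable_comp_Ico_mul μ ((differentiableOn_div_one_sub f.2.1).deriv
      Metric.isOpen_ball).continuousOn hna
    have h2 : Integrable (fun t => ((φ t : ℝ) : ℂ)) μ := by
      simp only [← hcoe]
      refine h1.mono (AEStronglyMeasurable.mul (Continuous.aestronglyMeasurable (by fun_prop))
        h1.1) (ae_of_all _ fun t => ?_)
      rw [norm_mul, Complex.norm_real, Real.norm_of_nonneg t.2.1]
      exact mul_le_of_le_one_left (norm_nonneg _) t.2.2.le
    exact h2.re
  rw [(hasDerivAt_cesaroLike μ f hna).deriv]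
  simp only [hcoe]
  rw [integral_complex_ofReal, Complex.norm_real]
  refine le_trans ?_ (le_abs_self _)
  refine le_trans ?_ (mul_meas_ge_le_integral_of_nonneg (ae_of_all _ hφ0) hint
    (a * (c * (-Real.log (1 - a ^ 3)) / (1 - a ^ 2) ^ 2)))
  have ha2 : 0 < 1 - a ^ 2 := by nlinarith
  have ha3 : 0 < 1 - a ^ 3 := by nlinarith
  have hl3 : Real.log (1 - a ^ 3) ≤ 0 := Real.log_nonpos ha3.le (by linarith [pow_pos ha0 3])
  refine mul_le_mul_of_nonneg_left ?_ (mul_nonneg ha0.le (div_nonneg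
    (mul_nonneg hc (by linarith)) (by positivity)))
  refine ENNReal.toReal_mono (measure_ne_top _ _) (measure_mono fun t ht => ?_)
  have hat : a ≤ t := ht
  obtain ⟨h0, h1⟩ := hta t
  have h2 : 0 < 1 - a * (t * a) := by nlinarith
  have h4 : 0 < 1 - t * a := by linarith
  have h5 : 0 ≤ a / (1 - a * (t * a)) * (1 - t * a) := by positivity
  have h6 : a ^ 2 ≤ t * a := by nlinarith
  have h7 : Real.log (1 - a * (t * a)) ≤ Real.log (1 - a ^ 3) :=
    Real.log_le_log h2 (by nlinarith)
  change a * (c * (-Real.log (1 - a ^ 3)) / (1 - a ^ 2) ^ 2) ≤ φ t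
  refine mul_le_mul hat ?_ (div_nonneg (mul_nonneg hc (by linarith)) (by positivity)) t.2.1
  refine div_le_div₀ (mul_nonneg hc (by linarith)) (mul_le_mul_of_nonneg_left (by linarith) hc)
    (by positivity) ?_
  gcongr

theorem isVanishingLogCarleson_of_compact [CompleteSpace X] {p q : ℝ} [Fact (1 < p)]
    (hpq : p.HolderConjugate q) (hX : IsSpaceOfAnalyticFunctions ι)
    (hB : Set.range ι ⊆ blochSpace) {μ : Measure (Set.Ico (0 : ℝ) 1)} [IsFiniteMeasure μ]
    {T : Besov p →L[ℂ] X} (hT : ∀ f : Besov p, (ι (T f) : ℂ → ℂ) = cesaroLike μ (Besov.toHol f))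
    (hTc : IsCompactOperator T) : IsVanishingLogCarleson (1 / q) 1 μ := by
  obtain ⟨F, C, hF⟩ := Besov.exists_testFunctions p
  obtain ⟨D, hD⟩ := hX.exists_bloch_bound hB
  have h0 := tendsto_compact_testFunctions hX hT hTc hF
  have h1 : Tendsto (fun a => 8 * (D * ‖T (F a)‖)) (𝓝[<] 1) (𝓝 0) := by
    have := (h0.norm.const_mul D).const_mul 8
    simpa using this
  refine squeeze_zero' ?_ ?_ h1
  · filter_upwards [Ioo_mem_nhdsLT (show (0 : ℝ) < 1 by norm_num)] with a ha
    have hL := one_le_logWeight ha.1.le ha.2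
    have : 0 < 1 - a := by linarith [ha.2]
    rw [log_exp_one_div ha.2]
    positivity
  · filter_upwards [Ioo_mem_nhdsLT (show (1 / 2 : ℝ) < 1 by norm_num),
      -- As `1 - a³ ≤ 3(1-a)`, one has `-log(1-a³) ≥ logWeight a - 1 - log 3`; this threshold makes
      -- that at least half the weight.
      tendsto_logWeight.eventually_ge_atTop (2 * (1 + Real.log 3))] with a ha hLa
    have ha0 : 0 < a := by linarith [ha.1]
    have ha1 := ha.2
    have hL := one_le_logWeight ha0.le ha1
    have hδ : 0 < 1 - a := by linarith
    have hna : ‖(a : ℂ)‖ = a := by rw [Complex.norm_real, Real.norm_of_nonneg ha0.le]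
    have h2 := hD (T (F a)) a (by rwa [hna])
    rw [hna, hT] at h2
    have h3 := measure_mul_le_norm_deriv_cesaroLike ha0 ha1
      (show 0 ≤ logWeight a ^ (-(1 / p)) by positivity) μ (hF a ha0.le ha1).2
    rw [log_exp_one_div ha1, Real.rpow_one]
    have ha2 : 0 < 1 - a ^ 2 := by nlinarith
    have ha3 : 0 < 1 - a ^ 3 := by nlinarith
    set m := (μ {x | a ≤ (x : ℝ)}).toReal with hm
    have hm0 : 0 ≤ m := ENNReal.toReal_nonneg
    have hlog : logWeight a / 2 ≤ -Real.log (1 - a ^ 3) := by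
      have h4 := Real.log_le_log ha3 (show 1 - a ^ 3 ≤ 3 * (1 - a) by nlinarith [sq_nonneg (1 - a)])
      rw [Real.log_mul (by norm_num) hδ.ne'] at h4
      unfold logWeight at hLa ⊢
      linarith
    have hpow : logWeight a ^ (1 / q) = logWeight a ^ (-(1 / p)) * logWeight a := by
      have h5 := Real.rpow_add (by linarith : 0 < logWeight a) (-(1 / p)) 1
      rw [Real.rpow_one] at h5
      rw [← h5]
      congr 1
      have := hpq.inv_add_inv_eq_one
      rw [one_div, one_div]
      linarith
    set c := logWeight a ^ (-(1 / p)) with hc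
    have hc0 : 0 ≤ c := by positivity
    -- The 8 collects three factors of 2: from `a ≥ 1/2`, from the halved logarithm, and from `1 -
    -- a² ≤ 2(1-a)`.
    calc m * logWeight a ^ (1 / q) / (1 - a)
        = 8 * ((1 / 2) * (c * (logWeight a / 2)) / (2 * (1 - a)) * m) := by
          rw [hpow]
          field_simp
          ring
      _ ≤ 8 * (a * (c * (-Real.log (1 - a ^ 3))) / (1 - a ^ 2) * m) := by
          have h6 : 0 ≤ -Real.log (1 - a ^ 3) := by linarith
          gcongr
          · exact ha.1.le
          · nlinarith
      _ = 8 * ((1 - a ^ 2) *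
          (a * (c * (-Real.log (1 - a ^ 3)) / (1 - a ^ 2) ^ 2) * m)) := by
          field_simp
      _ ≤ 8 * ((1 - a ^ 2) * ‖deriv (cesaroLike μ (Besov.toHol (F a))) a‖) := by gcongr
      _ ≤ _ := by gcongr

end Necessity

/-! ### The equivalence -/

theorem theorem3p2 (p q s : ℝ) [Fact (1 < p)] (hs : 1 < s) (hpq : 1 / p + 1 / q = 1)
    {X : Type*} [NormedAddCommGroup X] [NormedSpace ℂ X] [CompleteSpace X]
    (ι : X →ₗ[ℂ] HolDisc) (hX : IsSpaceOfAnalyticFunctions ι)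
    (hlower : meanLipschitz s (1 / s) ⊆ Set.range ι) (hupper : Set.range ι ⊆ blochSpace)
    (μ : MeasureTheory.Measure (Set.Ico (0 : ℝ) 1)) [MeasureTheory.IsFiniteMeasure μ] :
    (∃ T : Besov p →L[ℂ] X,
        (∀ f : Besov p, (ι (T f) : ℂ → ℂ) = cesaroLike μ (Besov.toHol f)) ∧
        IsCompactOperator T) ↔
      IsVanishingLogCarleson (1 / q) 1 μ := by
  have hc : p.HolderConjugate q :=
    Real.holderConjugate_iff.2 ⟨Fact.out, by simpa only [one_div] using hpq⟩
  have hs0 : 0 < s := by linarith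
  have hsi : 1 / s < 1 := (div_lt_one hs0).2 hs
  have hsp : 0 < 1 / s := by positivity
  constructor
  · rintro ⟨T, hT, hTc⟩
    exact isVanishingLogCarleson_of_compact hc hX hupper hT hTc
  · intro hμ
    -- The choice of `ε` as half of `1 - 1/s` places `s(1-ε)` midway between 1 and `s`.
    have hε : 1 < s * (1 - (1 - 1 / s) / 2) := by
      have : s * (1 - (1 - 1 / s) / 2) = (s + 1) / 2 := by
        field_simp
        ring
      linarith
    obtain ⟨T, hT, hTc⟩ := exists_compact_cesaro hc hX (ε := (1 - 1 / s) / 2) (by linarith)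
      (by linarith) (fun g K hg => hlower (hg.mem_meanLipschitz hs hε)) μ hμ
    exact ⟨T, fun f => by rw [hT]; rfl, hTc⟩
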